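/- Let $q>0$ be real and let $H_n(q)$ be the Hecke algebra: the unital associative $\mathbb{C}$-algebra generated by $g_1,\dots,g_{n-1}$ with relations $g_i^2=(q-1)g_i+q$, $g_ig_{i+1}g_i=g_{i+1}g_ig_{i+1}$, and $g_ig_j=g_jg_i$ for $|i-j|\ge 2$. Put $[k]_q=\frac{q^k-1}{q-1}$ and $[[k]]_q=q^{-(k-1)/2}[k]_q$ (with $[k]_q=[[k]]_q=k$ at $q=1$). For $j\ge 1$ and $p\ge 2$ with $p+j-1\le n$ define the Murphy operators $$L_p^{(j)}=\sum_{k=0}^{p-2}q^{-k}\,g_{p+j-2-k}\cdots g_{p+j-3}\,g_{p+j-2}\,g_{p+j-3}\cdots g_{p+j-2-k},\qquad L_p=L_p^{(1)},$$ and, for $i,j\ge 1$ with $i+j\le n$, the rescaled single-row projectors $$e_j^{(i)}=[[i+1]]_q\prod_{p=2}^{i+1}\frac{L_p^{(j)}+1}{[p]_q}.$$ Then the following hold. 1. For $i,j\ge1$ with $i+j\le n$: $\ (e_j^{(i)})^2=[[i+1]]_q\,e_j^{(i)}$. 2. For $i,j\ge1$ with $i+j+1\le n$: $$e_j^{(i+1)}=\frac{1}{[[i]]_q[[i+1]]_q}\left(e_j^{(i)}e_{j+1}^{(i)}e_j^{(i)}-e_j^{(i)}\right).$$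 3. For $i,j\ge1$ with $i+j+1\le n$: $$e_j^{(i)}e_{j+1}^{(i)}e_j^{(i)}-e_j^{(i)}=e_{j+1}^{(i)}e_j^{(i)}e_{j+1}^{(i)}-e_{j+1}^{(i)}.$$ 4. Let $\ell\ge 2$. The $\ell$-column Temperley–Lieb–Martin algebra is the quotient of $H_n(q)$ by the two-sided ideal $I$ generated by the elements $$e_j^{(\ell-1)}e_{j\pm1}^{(\ell-1)}e_j^{(\ell-1)}-e_j^{(\ell-1)},$$ where $j$ and $j\pm1$ both lie in $\{1,\dots,n-\ell+1\}$. That is, the irreducible representations of $H_n(q)/I$ are exactly the irreducible representations of $H_n(q)$ labelled by Young diagrams with at most $\ell$ columns, and $H_n(q)/I$ is the largest quotient of $H_n(q)$ admitting only such irreducible representations: $I\subseteq K$ for every two-sided ideal $K$ such that all irreducible representations of $H_n(q)/K$ have this form. Here an irreducible representation is labelled by a Young diagram $\Gamma$ with $n$ boxes if it contains a nonzero vector $v$ for which there is a chain $\varnothing=\Gamma_0\subset\Gamma_1\subset\dots\subset\Gamma_n=\Gamma$ of Young diagrams, $\Gamma_p$ having $p$ boxes, such that $L_pv=q[c-r]_q\,v$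 for $2\le p\le n$, where the box added to $\Gamma_{p-1}$ to obtain $\Gamma_p$ lies in row $r$ and column $c$. -/

import Mathlib

/-- `[k]_q = (q ^ k - 1) / (q - 1)` for an integer `k`, with its limiting value `k` at `q = 1`. -/
noncomputable def qInt (q : ℝ) (k : ℤ) : ℝ :=
  if q = 1 then (k : ℝ) else (q ^ k - 1) / (q - 1)

/-- `[[k]]_q = q ^ (-(k - 1) / 2) [k]_q`, which is
`(q ^ (k / 2) - q ^ (-k / 2)) / (q ^ (1 / 2) - q ^ (-1 / 2))` for `q ≠ 1`, and `k` at `q = 1`. -/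
noncomputable def qSym (q : ℝ) (k : ℕ) : ℝ :=
  q ^ (-((k : ℝ) - 1) / 2) * qInt q (k : ℤ)

/-- The index set `{1, …, n - 1}` of the generators of the Hecke algebra. -/
abbrev HeckeIndex (n : ℕ) : Type := {j : ℕ // 1 ≤ j ∧ j < n}

/-- The defining relations of the Hecke algebra `H_n(q)`. -/
inductive HeckeRel (n : ℕ) (q : ℝ) :
    FreeAlgebra ℂ (HeckeIndex n) → FreeAlgebra ℂ (HeckeIndex n) → Prop
  | quad (i : HeckeIndex n) :
      HeckeRel n q (FreeAlgebra.ι ℂ i * FreeAlgebra.ι ℂ i)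
        (((q - 1 : ℝ) : ℂ) • FreeAlgebra.ι ℂ i + algebraMap ℂ _ (q : ℂ))
  | braid (i j : HeckeIndex n) (h : j.1 = i.1 + 1) :
      HeckeRel n q (FreeAlgebra.ι ℂ i * FreeAlgebra.ι ℂ j * FreeAlgebra.ι ℂ i)
        (FreeAlgebra.ι ℂ j * FreeAlgebra.ι ℂ i * FreeAlgebra.ι ℂ j)
  | comm (i j : HeckeIndex n) (h : i.1 + 2 ≤ j.1) :
      HeckeRel n q (FreeAlgebra.ι ℂ i * FreeAlgebra.ι ℂ j)
        (FreeAlgebra.ι ℂ j * FreeAlgebra.ι ℂ i)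

/-- The Hecke algebra `H_n(q)` over `ℂ`. -/
abbrev Hecke (n : ℕ) (q : ℝ) : Type := RingQuot (HeckeRel n q)

/-- The generator `g_j`, for `1 ≤ j ≤ n - 1` (and `0` for other values of `j`). -/
noncomputable def heckeGen (n : ℕ) (q : ℝ) (j : ℕ) : Hecke n q :=
  if h : 1 ≤ j ∧ j < n then
    RingQuot.mkAlgHom ℂ (HeckeRel n q) (FreeAlgebra.ι ℂ (⟨j, h⟩ : HeckeIndex n))
  else 0

/-- The palindromic word `g_a g_{a+1} ⋯ g_{a+k} ⋯ g_{a+1} g_a`. -/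
noncomputable def heckePalin (n : ℕ) (q : ℝ) : ℕ → ℕ → Hecke n q
  | a, 0 => heckeGen n q a
  | a, k + 1 => heckeGen n q a * heckePalin n q (a + 1) k * heckeGen n q a

/-- The Murphy operator `L_p^{(i)}`, `p ≥ 2`, of the subalgebra generated by `g_i, g_{i+1}, …`:
the sum over `k = 0, …, p - 2` of `q ^ (-k)` times the word
`g_{p+i-2-k} ⋯ g_{p+i-2} ⋯ g_{p+i-2-k}`. -/
noncomputable def murphy (n : ℕ) (q : ℝ) (i p : ℕ) : Hecke n q :=
  ∑ k ∈ Finset.range (p - 1), (((q ^ k)⁻¹ : ℝ) : ℂ) • heckePalin n q (p + i - 2 - k) k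

/-- The projector `C_m^{(i)} = ∏_{p = 2}^{m} (L_p^{(i)} + 1) / [p]_q`, factors in increasing order
of `p`, onto the single-row representation of the subalgebra generated by `g_i, …, g_{i+m-2}`. -/
noncomputable def rowProj (n : ℕ) (q : ℝ) (i m : ℕ) : Hecke n q :=
  ((List.range (m - 1)).map fun k =>
    (((qInt q ((k + 2 : ℕ) : ℤ))⁻¹ : ℝ) : ℂ) • (murphy n q i (k + 2) + 1)).prod

/-- The rescaled projector `e_j^{(i)} = [[i+1]]_q C_{i+1}^{(j)}`; it lies in the subalgebra
generated by `g_j, …, g_{j+i-1}` and is meaningful for `1 ≤ j` and `j + i ≤ n`. -/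
noncomputable def eProj (n : ℕ) (q : ℝ) (i j : ℕ) : Hecke n q :=
  ((qSym q (i + 1) : ℝ) : ℂ) • rowProj n q j (i + 1)

/-- The `q`-content `q [col - row]_q` of a box (`(row, col)`, both counted from `0`). -/
noncomputable def qContent (q : ℝ) (b : ℕ × ℕ) : ℝ :=
  q * qInt q ((b.2 : ℤ) - (b.1 : ℤ))

/-- The irreducible representation `V` of `H_n(q)` is labelled by the Young diagram `μ` with `n`
boxes: `V` contains a state labelled by a chain of Young diagrams `Γ_0 ⊂ Γ_1 ⊂ ⋯ ⊂ Γ_n = μ`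
with `|Γ_p| = p`, that is, a nonzero common eigenvector of the Murphy operators `L_2, …, L_n`
such that the eigenvalue of `L_p` is the `q`-content of the box added to `Γ_{p-1}` to get `Γ_p`. -/
def IsLabelledBy (n : ℕ) (q : ℝ) (V : Type*) [AddCommGroup V] [Module (Hecke n q) V]
    (μ : YoungDiagram) : Prop :=
  ∃ Γ : ℕ → YoungDiagram,
    (∀ p ≤ n, (Γ p).card = p) ∧ (∀ p < n, Γ p ≤ Γ (p + 1)) ∧ Γ n = μ ∧
    ∃ v : V, v ≠ 0 ∧ ∀ p, 2 ≤ p → p ≤ n → ∀ b ∈ (Γ p).cells \ (Γ (p - 1)).cells,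
      murphy n q 1 p • v = algebraMap ℂ (Hecke n q) ((qContent q b : ℝ) : ℂ) • v

/-- `V` is labelled by a Young diagram with at most `l` columns. -/
def HasAtMostColumns (n : ℕ) (q : ℝ) (l : ℕ) (V : Type*) [AddCommGroup V]
    [Module (Hecke n q) V] : Prop :=
  ∃ μ : YoungDiagram, IsLabelledBy n q V μ ∧ μ.rowLen 0 ≤ l

/-- The `H_n(q)`-module `V` is a module of the quotient algebra `H_n(q) / I`. -/
def FactorsThrough (n : ℕ) (q : ℝ) (I : TwoSidedIdeal (Hecke n q)) (V : Type*) [AddCommGroup V]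
    [Module (Hecke n q) V] : Prop :=
  ∀ x ∈ I, ∀ v : V, x • v = 0

/-- `H_n(q) / I` is the `l`-column Temperley-Lieb-Martin algebra: its irreducible representations
are exactly the irreducible representations of `H_n(q)` labelled by Young diagrams with at most
`l` columns, and it is the largest quotient of `H_n(q)` that admits only such irreducible
representations. -/
structure IsTemperleyLiebMartin (n : ℕ) (q : ℝ) (l : ℕ) (I : TwoSidedIdeal (Hecke n q)) :
    Prop where
  irreps : ∀ (V : Type) [AddCommGroup V] [Module (Hecke n q) V] [IsSimpleModule (Hecke n q) V],
    FactorsThrough n q I V ↔ HasAtMostColumns n q l V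
  largest : ∀ K : TwoSidedIdeal (Hecke n q),
    (∀ (V : Type) [AddCommGroup V] [Module (Hecke n q) V] [IsSimpleModule (Hecke n q) V],
      FactorsThrough n q K V → HasAtMostColumns n q l V) → I ≤ K

/-- The elements `e_j^{(i)} e_{j±1}^{(i)} e_j^{(i)} - e_j^{(i)}` of `H_n(q)`, for all indices
`j` and `j ± 1` in the range `1, …, n - i`. -/
def tlRelators (n : ℕ) (q : ℝ) (i : ℕ) : Set (Hecke n q) :=
  {x | ∃ j k : ℕ, 1 ≤ j ∧ j + i ≤ n ∧ 1 ≤ k ∧ k + i ≤ n ∧ (k = j + 1 ∨ j = k + 1) ∧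
    x = eProj n q i j * eProj n q i k * eProj n q i j - eProj n q i j}

/-! The product defining `e_j^{(i)}` is a rescaled `q`-symmetrizer `S` of the generators `g_j, …,
g_{j+i-1}`. It is characterised by absorption: each of these generators multiplies it, on either
side, by `q`. Absorption comes from writing `S` as a sum over descending words, the minimal coset
representatives of each Hecke subalgebra in the next (`sym_mul_gen`). Idempotency follows at once,
and so does invariance under reversing the generators.

Expanding both the next symmetrizer and `S S' S`, with `S'` the shift of `S`, over the same
descending words gives combinations of `S` and `S g S`; comparing coefficients proves the recursion
(`smul_sym_succ_eq`). Its left side is a multiple of the next symmetrizer, which reversal fixes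
while exchanging `e_j` and `e_{j+1}`; this is the braid-like identity (`braid_sub_eq`).

Consequently the relators are nonzero multiples of the `e_j^{(ℓ)}`, and a module killed by
`e_1^{(ℓ)}` is killed by all of them. It remains to show that a simple module is killed by
`e_1^{(ℓ)}` iff it is labelled by a diagram with at most `ℓ` columns.

For one direction, a vector in the image of the symmetrizer has eigenvalue `q[ℓ]_q` under `L_{ℓ+1}`.
A symmetric polynomial in the Murphy operators is central, so the multiset of contents is constant
on a simple module; hence a label must have a box of content `ℓ` and therefore more than `ℓ`
columns.

For the converse, an invariant positive definite form (here `q > 0` enters) restricts the joint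
spectrum of the Murphy operators in the style of Okounkov and Vershik. Choosing the largest possible
content at every step yields a tableau read row by row (`WeightSystem.exists_chain`). If its first
row had more than `ℓ` boxes, the symmetrizer would fix the corresponding vector.

Maximality of the quotient follows because the symmetrizers are idempotent: an idempotent killing
every simple module of `H_n(q)/K` lies in `K`. -/

/-! ### Hecke relations and commutation of Jucys-Murphy elements. -/

section HeckeSystem

variable {K A : Type*} [Field K] [Ring A] [Algebra K A]

/-- Elements `h 0, …, h (N - 1)` of a `K`-algebra that satisfy the relations of the generators of
the Hecke algebra with parameter `Q`. -/
structure HeckeSystem (Q : K) (N : ℕ) (h : ℕ → A) : Prop where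
  quad : ∀ i < N, h i * h i = (Q - 1) • h i + Q • (1 : A)
  braid : ∀ i, i + 1 < N → h i * h (i + 1) * h i = h (i + 1) * h i * h (i + 1)
  comm : ∀ i j, i + 2 ≤ j → j < N → h i * h j = h j * h i

/-- The palindromic word `h a ⋯ h (a + k) ⋯ h a`. -/
def palin (h : ℕ → A) : ℕ → ℕ → A
  | a, 0 => h a
  | a, k + 1 => h a * palin h (a + 1) k * h a

/-- The Jucys-Murphy element in the first `m` generators. -/
def jm (Q : K) (h : ℕ → A) (m : ℕ) : A :=
  ∑ k ∈ Finset.range m, (Q ^ k)⁻¹ • palin h (m - 1 - k) k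

/-- The geometric sum `1 + Q + ⋯ + Q ^ (k - 1)`. -/
def qNum (Q : K) (k : ℕ) : K := ∑ i ∈ Finset.range k, Q ^ i

/-- The symmetrizer in the first `m` generators. -/
def sym (Q : K) (h : ℕ → A) : ℕ → A
  | 0 => 1
  | m + 1 => (qNum Q (m + 2))⁻¹ • (sym Q h m * (jm Q h (m + 1) + 1))

/-- The descending word `h m * h (m - 1) * ⋯` with `k` factors. -/
def desc (h : ℕ → A) (m : ℕ) : ℕ → A
  | 0 => 1
  | k + 1 => desc h m k * h (m - k)

lemma qNum_succ (Q : K) (k : ℕ) : qNum Q (k + 1) = qNum Q k + Q ^ k :=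
  Finset.sum_range_succ _ _

lemma qNum_succ' (Q : K) (k : ℕ) : qNum Q (k + 1) = Q * qNum Q k + 1 := by
  simp [qNum, Finset.sum_range_succ', Finset.mul_sum, pow_succ']

lemma palin_shift (h : ℕ → A) (c k : ℕ) : ∀ a,
    palin (fun t => h (t + c)) a k = palin h (a + c) k := by
  induction k with
  | zero => intro a; rfl
  | succ k ih => intro a; rw [palin, palin, ih, add_right_comm]

lemma jm_shift (Q : K) (h : ℕ → A) (c m : ℕ) :
    jm Q (fun t => h (t + c)) m =
      ∑ k ∈ Finset.range m, (Q ^ k)⁻¹ • palin h (m - 1 - k + c) k := by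
  simp only [jm, palin_shift]

section Map

variable {B : Type*} [Ring B] [Algebra K B]

lemma map_palin (φ : A →ₐ[K] B) (h : ℕ → A) (k : ℕ) : ∀ a,
    φ (palin h a k) = palin (fun t => φ (h t)) a k := by
  induction k with
  | zero => intro a; rfl
  | succ k ih => intro a; rw [palin, palin, map_mul, map_mul, ih]

lemma map_jm (φ : A →ₐ[K] B) (Q : K) (h : ℕ → A) (m : ℕ) :
    φ (jm Q h m) = jm Q (fun t => φ (h t)) m := by
  simp [jm, map_palin]

lemma HeckeSystem.map {Q : K} {N : ℕ} {h : ℕ → A} (H : HeckeSystem Q N h) (φ : A →ₐ[K] B) :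
    HeckeSystem Q N fun t => φ (h t) where
  quad i hi := by simpa using congrArg φ (H.quad i hi)
  braid i hi := by simpa using congrArg φ (H.braid i hi)
  comm i j hij hj := by simpa using congrArg φ (H.comm i j hij hj)

end Map

lemma op_palin (h : ℕ → A) (k : ℕ) : ∀ a,
    MulOpposite.op (palin h a k) = palin (fun t => MulOpposite.op (h t)) a k := by
  induction k with
  | zero => intro a; rfl
  | succ k ih => intro a; rw [palin, palin, MulOpposite.op_mul, MulOpposite.op_mul, ih, mul_assoc]

lemma op_jm (Q : K) (h : ℕ → A) (m : ℕ) :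
    MulOpposite.op (jm Q h m) = jm Q (fun t => MulOpposite.op (h t)) m := by
  simp [jm, op_palin]

namespace HeckeSystem

variable {Q : K} {N : ℕ} {h : ℕ → A}

lemma op (H : HeckeSystem Q N h) : HeckeSystem Q N fun t => MulOpposite.op (h t) where
  quad i hi := by simpa using congrArg MulOpposite.op (H.quad i hi)
  braid i hi := by simpa [mul_assoc] using congrArg MulOpposite.op (H.braid i hi)
  comm i j hij hj := by simpa using congrArg MulOpposite.op (H.comm i j hij hj).symm

lemma mono (H : HeckeSystem Q N h) {M : ℕ} (hM : M ≤ N) : HeckeSystem Q M h where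
  quad i hi := H.quad i (by omega)
  braid i hi := H.braid i (by omega)
  comm i j hij hj := H.comm i j hij (by omega)

lemma shift (H : HeckeSystem Q N h) {M c : ℕ} (hM : M + c ≤ N) :
    HeckeSystem Q M fun t => h (t + c) where
  quad i hi := H.quad _ (by omega)
  braid i hi := by
    have := H.braid (i + c) (by omega)
    rwa [add_right_comm] at this
  comm i j hij hj := H.comm _ _ (by omega) (by omega)

lemma reverse (H : HeckeSystem Q N h) {h' : ℕ → A} (H' : ∀ i < N, h' i = h (N - 1 - i)) :
    HeckeSystem Q N h' where
  quad i hi := by rw [H' i hi]; exact H.quad _ (by omega)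
  braid i hi := by
    rw [H' i (by omega), H' (i + 1) hi]
    have := H.braid (N - 1 - (i + 1)) (by omega)
    rw [show N - 1 - (i + 1) + 1 = N - 1 - i by omega] at this
    exact this.symm
  comm i j hij hj := by
    rw [H' i (by omega), H' j hj]
    exact (H.comm _ _ (by omega) (by omega)).symm

lemma commute_gen (H : HeckeSystem Q N h) {i j : ℕ} (hi : i < N) (hj : j < N)
    (hij : i + 2 ≤ j ∨ j + 2 ≤ i) : Commute (h i) (h j) := by
  rcases hij with hij | hij
  · exact H.comm i j hij hj
  · exact (H.comm j i hij hi).symm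

/-- The braid relation lets the palindrome be turned inside out; this is what makes the recursion
`jm_succ` for Jucys-Murphy elements possible. -/
lemma palin_succ' (H : HeckeSystem Q N h) (k : ℕ) : ∀ a, a + k + 1 < N →
    palin h a (k + 1) = h (a + k + 1) * palin h a k * h (a + k + 1) := by
  induction k with
  | zero => intro a ha; exact H.braid a ha
  | succ k ih =>
    intro a ha
    have c : h a * h (a + k + 2) = h (a + k + 2) * h a := H.comm a (a + k + 2) (by omega) ha
    rw [palin, ih (a + 1) (by omega), palin, show a + 1 + k + 1 = a + k + 2 by ring,
      show a + (k + 1) + 1 = a + k + 2 by ring]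
    calc _ = (h a * h (a + k + 2)) * palin h (a + 1) k * (h (a + k + 2) * h a) := by
          simp only [mul_assoc]
      _ = _ := by rw [← c]; simp only [← mul_assoc]; rw [c]

lemma jm_succ (H : HeckeSystem Q N h) {m : ℕ} (hm : m < N) :
    jm Q h (m + 1) = Q⁻¹ • (h m * jm Q h m * h m) + h m := by
  rw [jm, Finset.sum_range_succ', jm, Finset.mul_sum, Finset.sum_mul, Finset.smul_sum]
  congr 1
  · refine Finset.sum_congr rfl fun k hk => ?_
    rw [Finset.mem_range] at hk
    rw [H.palin_succ' k _ (by omega), show m + 1 - 1 - (k + 1) + k + 1 = m by omega,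
      show m + 1 - 1 - (k + 1) = m - 1 - k by omega]
    simp [smul_smul, pow_succ, mul_comm]
  · simp [palin]

lemma commute_jm_of_lt (H : HeckeSystem Q N h) {i m : ℕ} (hi : i < N) (hm : m < i) :
    Commute (h i) (jm Q h m) := by
  induction m with
  | zero => simp [jm]
  | succ m ih =>
    have c := H.commute_gen (i := i) (j := m) hi (by omega) (by omega)
    rw [H.jm_succ (by omega)]
    exact (((c.mul_right (ih (by omega))).mul_right c).smul_right _).add_right c

/-- Multiply the recursion `jm_succ` by `h m` and reduce the square. This exchange relation and its
mirror image are all that the weight theory needs about neighbouring Jucys-Murphy elements. -/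
lemma gen_mul_jm_succ (H : HeckeSystem Q N h) (hQ : Q ≠ 0) {m : ℕ} (hm : m < N) :
    h m * jm Q h (m + 1) = jm Q h m * h m + (Q - 1) • jm Q h (m + 1) + Q • (1 : A) := by
  have e : h m * jm Q h m * h m = Q • (jm Q h (m + 1) - h m) := by
    rw [H.jm_succ hm, add_sub_cancel_right, smul_smul, mul_inv_cancel₀ hQ, one_smul]
  have q := H.quad m hm
  calc h m * jm Q h (m + 1) = Q⁻¹ • (h m * h m * jm Q h m * h m) + h m * h m := by
        rw [H.jm_succ hm]; simp only [mul_add, mul_smul_comm, mul_assoc]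
    _ = Q⁻¹ • ((Q - 1) • (h m * jm Q h m * h m) + Q • (jm Q h m * h m)) +
          ((Q - 1) • h m + Q • (1 : A)) := by
        rw [q]; simp only [add_mul, smul_mul_assoc, one_mul]
    _ = _ := by
        rw [e]
        match_scalars <;> field_simp
        ring

lemma jm_succ_mul_gen (H : HeckeSystem Q N h) (hQ : Q ≠ 0) {m : ℕ} (hm : m < N) :
    jm Q h (m + 1) * h m = h m * jm Q h m + (Q - 1) • jm Q h (m + 1) + Q • (1 : A) := by
  have := H.op.gen_mul_jm_succ hQ hm
  rw [← op_jm, ← op_jm] at this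
  simpa using congrArg MulOpposite.unop this

lemma commute_jm_add_two (H : HeckeSystem Q N h) (hQ : Q ≠ 0) {m : ℕ} (hm : m + 1 < N) :
    Commute (h m) (jm Q h (m + 2)) := by
  have c : h (m + 1) * jm Q h m = jm Q h m * h (m + 1) :=
    (H.commute_jm_of_lt hm (Nat.lt_succ_self m)).eq
  have b := H.braid m hm
  have q := H.quad m (by omega)
  set a := h (m + 1)
  set b' := h m
  set X := jm Q h m
  have e : jm Q h (m + 2) = (Q⁻¹ * Q⁻¹) • (a * b' * X * b' * a) + Q⁻¹ • (a * b' * a) + a := by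
    rw [H.jm_succ hm, H.jm_succ (by omega : m < N)]
    simp only [mul_add, add_mul, mul_smul_comm, smul_mul_assoc, smul_add, smul_smul, mul_assoc,
      a, b', X]
  have e1 : b' * (a * b' * X * b' * a) = a * b' * X * b' * a * b' := by
    calc b' * (a * b' * X * b' * a) = (b' * a * b') * X * b' * a := by simp only [mul_assoc]
      _ = a * b' * (a * X) * b' * a := by rw [b]; simp only [mul_assoc]
      _ = a * b' * X * (a * b' * a) := by rw [c]; simp only [mul_assoc]
      _ = _ := by rw [← b]; simp only [mul_assoc]
  have e2 : b' * (a * b' * a) = (Q - 1) • (a * b' * a) + Q • (a * b') := by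
    calc b' * (a * b' * a) = (b' * b') * (a * b') := by rw [← b]; simp only [mul_assoc]
      _ = (Q - 1) • (b' * a * b') + Q • (a * b') := by
        rw [q]; simp only [add_mul, smul_mul_assoc, one_mul, mul_assoc]
      _ = _ := by rw [b]
  have e3 : a * b' * a * b' = (Q - 1) • (a * b' * a) + Q • (b' * a) := by
    calc a * b' * a * b' = (b' * a) * (b' * b') := by rw [← b]; simp only [mul_assoc]
      _ = (Q - 1) • (b' * a * b') + Q • (b' * a) := by
        rw [q]; simp only [mul_add, mul_smul_comm, mul_one, mul_assoc]
      _ = _ := by rw [b]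
  rw [Commute, SemiconjBy, e]
  simp only [mul_add, add_mul, mul_smul_comm, smul_mul_assoc]
  rw [e1, e2, e3]
  match_scalars <;> field_simp

lemma commute_jm_of_add_two_le (H : HeckeSystem Q N h) (hQ : Q ≠ 0) {i m : ℕ} (hm : m ≤ N)
    (him : i + 2 ≤ m) : Commute (h i) (jm Q h m) := by
  induction m with
  | zero => omega
  | succ m ih =>
    rcases Nat.eq_or_lt_of_le him with e | hlt
    · rw [← e]; exact H.commute_jm_add_two hQ (by omega)
    · have c := H.commute_gen (i := i) (j := m) (by omega) (by omega) (by omega)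
      rw [H.jm_succ (by omega)]
      exact (((c.mul_right (ih (by omega) (by omega))).mul_right c).smul_right _).add_right c

lemma commute_jm_jm (H : HeckeSystem Q N h) (hQ : Q ≠ 0) {i m : ℕ} (hi : i ≤ N) (hm : m ≤ N) :
    Commute (jm Q h i) (jm Q h m) := by
  wlog hle : i ≤ m generalizing i m
  · exact (this hm hi (by omega)).symm
  rcases Nat.eq_or_lt_of_le hle with rfl | hlt
  · exact Commute.refl _
  clear hle
  induction i with
  | zero => simp [jm]
  | succ i ih =>
    have c := H.commute_jm_of_add_two_le hQ (i := i) hm hlt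
    rw [H.jm_succ (by omega)]
    exact (((c.mul_left (ih (by omega) (by omega))).mul_left c).smul_left _).add_left c

lemma commute_sym_jm (H : HeckeSystem Q N h) (hQ : Q ≠ 0) {i m : ℕ} (hi : i ≤ N) (hm : m ≤ N) :
    Commute (sym Q h i) (jm Q h m) := by
  induction i with
  | zero => exact Commute.one_left _
  | succ i ih =>
    exact ((ih (by omega)).mul_left ((H.commute_jm_jm hQ hi hm).add_left
      (Commute.one_left _))).smul_left _

/-- The factors of the symmetrizer commute, so reversing words does not change it. Statements about
right multiplication thus transfer to the left. -/
lemma op_sym (H : HeckeSystem Q N h) (hQ : Q ≠ 0) {m : ℕ} (hm : m ≤ N) :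
    MulOpposite.op (sym Q h m) = sym Q (fun t => MulOpposite.op (h t)) m := by
  induction m with
  | zero => rfl
  | succ m ih =>
    have c := (H.commute_sym_jm hQ (i := m) (by omega) hm).add_right (Commute.one_right _)
    rw [sym, sym, c.eq, ← ih (by omega), ← op_jm]
    rfl

lemma commute_desc (H : HeckeSystem Q N h) {m k i : ℕ} (hm : m < N) (hik : i + k < m) :
    Commute (h i) (desc h m k) := by
  induction k with
  | zero => exact Commute.one_right _
  | succ k ih =>
    exact (ih (by omega)).mul_right (H.commute_gen (by omega) (by omega) (by omega))

/-- When the word contains both `h (i + 1)` and `h i`, one braid move carries the generator through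
it and lowers its index by one. -/
lemma desc_mul_gen (H : HeckeSystem Q N h) {m k i : ℕ} (hm : m < N) (hi : i + 1 ≤ m)
    (hk : k ≤ m + 1) (hik : m < i + k) :
    desc h m k * h (i + 1) = h i * desc h m k := by
  induction k with
  | zero => omega
  | succ k ih =>
    rcases Nat.eq_or_lt_of_le hik with e | hlt
    · obtain ⟨k, rfl⟩ : ∃ k', k = k' + 1 := ⟨k - 1, by omega⟩
      have c := (H.commute_desc (k := k) (i := i) hm (by omega)).eq
      rw [desc, desc, show m - k = i + 1 by omega, show m - (k + 1) = i by omega]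
      calc desc h m k * h (i + 1) * h i * h (i + 1)
          = desc h m k * (h (i + 1) * h i * h (i + 1)) := by simp only [mul_assoc]
        _ = (desc h m k * h i) * h (i + 1) * h i := by
            rw [← H.braid i (by omega)]; simp only [mul_assoc]
        _ = _ := by rw [← c]; simp only [mul_assoc]
    · have c := (H.commute_gen (i := i + 1) (j := m - k) (by omega) (by omega) (by omega)).eq
      rw [desc, mul_assoc, ← c, ← mul_assoc, ih (by omega) (by omega), mul_assoc]

end HeckeSystem

/-- For sums over descending words: multiplication by a generator treats every term separately,
except two consecutive ones that mix. -/
lemma Finset.sum_range_eq_of_pair {M : Type*} [AddCommGroup M] {a b : ℕ → M} {n k : ℕ}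
    (hk : k + 1 < n) (h : ∀ j < n, j ≠ k → j ≠ k + 1 → a j = b j)
    (hp : a k + a (k + 1) = b k + b (k + 1)) :
    ∑ j ∈ Finset.range n, a j = ∑ j ∈ Finset.range n, b j := by
  have key : ∀ c : ℕ → M, ∑ j ∈ Finset.range n, c j =
      c k + c (k + 1) + ∑ j ∈ ((Finset.range n).erase k).erase (k + 1), c j := by
    intro c
    rw [← Finset.add_sum_erase _ c (Finset.mem_range.2 (by omega : k < n)),
      ← Finset.add_sum_erase _ c (show k + 1 ∈ (Finset.range n).erase k by simp [hk]), add_assoc]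
  rw [key a, key b, hp]
  congr 1
  refine Finset.sum_congr rfl fun j hj => ?_
  simp only [Finset.mem_erase, Finset.mem_range] at hj
  exact h j hj.2.2 hj.2.1 hj.1

/-! ### Symmetrizers: absorption, idempotency and the recursion. -/

namespace HeckeSystem

variable {Q : K} {N : ℕ} {h : ℕ → A}

lemma desc_succ_mul_gen (H : HeckeSystem Q N h) {m k : ℕ} (hm : m < N) :
    desc h m (k + 1) * h (m - k) = (Q - 1) • desc h m (k + 1) + Q • desc h m k := by
  rw [desc, mul_assoc, H.quad _ (by omega), mul_add, mul_smul_comm, mul_smul_comm, mul_one]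

lemma mul_palin_of_absorb {x : A} (k : ℕ) : ∀ a, (∀ i, i < a + k → x * h i = Q • x) →
    x * palin h a k = Q ^ k • (x * desc h (a + k) (k + 1)) := by
  induction k with
  | zero => intro a _; simp [palin, desc]
  | succ k ih =>
    intro a hx
    rw [palin, ← mul_assoc, ← mul_assoc, hx a (by omega), smul_mul_assoc, smul_mul_assoc,
      ih (a + 1) (fun i hi => hx i (by omega)), smul_mul_assoc, smul_smul, ← pow_succ',
      show a + 1 + k = a + (k + 1) by ring, desc.eq_2 h _ (k + 1),
      show a + (k + 1) - (k + 1) = a by omega, mul_assoc]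

/-- The ascending half of each palindrome below its peak is absorbed by `x`; the resulting power of
`Q` cancels the weight in `jm`, leaving the sum over coset representatives. -/
lemma mul_jm_of_absorb (hQ : Q ≠ 0) {x : A} {m : ℕ} (hx : ∀ i < m, x * h i = Q • x) :
    x * (jm Q h (m + 1) + 1) = ∑ k ∈ Finset.range (m + 2), x * desc h m k := by
  rw [Finset.sum_range_succ', mul_add, jm, Finset.mul_sum]
  congr 1
  refine Finset.sum_congr rfl fun k hk => ?_
  rw [Finset.mem_range] at hk
  rw [mul_smul_comm, mul_palin_of_absorb k _ fun i hi => hx i (by omega), smul_smul,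
    inv_mul_cancel₀ (pow_ne_zero _ hQ), one_smul, show m + 1 - 1 - k + k = m by omega]

lemma sym_mul_gen (H : HeckeSystem Q N h) (hQ : Q ≠ 0) {m : ℕ} (hm : m ≤ N) :
    ∀ i < m, sym Q h m * h i = Q • sym Q h m := by
  induction m with
  | zero => intro i hi; omega
  | succ m ih =>
    intro i hi
    have ih := ih (by omega)
    rw [sym, mul_jm_of_absorb hQ ih, smul_mul_assoc, smul_comm]
    congr 1
    rw [Finset.sum_mul, Finset.smul_sum]
    -- The words of length `m - i` and `m - i + 1` differ by a final `h i`, so they span a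
    -- two-dimensional piece governed by the quadratic relation. Past any other word the generator
    -- moves to the left, where `sym Q h m` absorbs it.
    refine Finset.sum_range_eq_of_pair (k := m - i) (by omega) (fun k hk h1 h2 => ?_) ?_
    · rcases Nat.lt_or_ge (i + k) m with hlt | hge
      · rw [mul_assoc, ← (H.commute_desc (m := m) (by omega) hlt).eq, ← mul_assoc,
          ih i (by omega), smul_mul_assoc]
      · obtain ⟨i, rfl⟩ : ∃ i', i = i' + 1 := ⟨i - 1, by omega⟩
        rw [mul_assoc, H.desc_mul_gen (m := m) (by omega) (by omega) (by omega) (by omega),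
          ← mul_assoc, ih i (by omega), smul_mul_assoc]
    · have e1 : desc h m (m - i) * h i = desc h m (m - i + 1) := by
        rw [desc, show m - (m - i) = i by omega]
      have e2 := H.desc_succ_mul_gen (m := m) (k := m - i) (by omega)
      rw [show m - (m - i) = i by omega] at e2
      rw [mul_assoc, mul_assoc, e1, e2]
      simp only [mul_add, mul_smul_comm]
      module

lemma gen_mul_sym (H : HeckeSystem Q N h) (hQ : Q ≠ 0) {m : ℕ} (hm : m ≤ N) :
    ∀ i < m, h i * sym Q h m = Q • sym Q h m := by
  intro i hi
  have := H.op.sym_mul_gen hQ hm i hi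
  rw [← H.op_sym hQ hm] at this
  simpa using congrArg MulOpposite.unop this

lemma palin_mul_of_absorb {y : A} (k : ℕ) : ∀ a, (∀ i, i ≤ a + k → h i * y = Q • y) →
    palin h a k * y = Q ^ (2 * k + 1) • y := by
  induction k with
  | zero => intro a hy; simpa [palin] using hy a (by simp)
  | succ k ih =>
    intro a hy
    rw [palin, mul_assoc, hy a (by omega), mul_smul_comm, mul_assoc,
      ih (a + 1) (fun i hi => hy i (by omega)), mul_smul_comm, hy a (by omega), smul_smul,
      smul_smul]
    congr 1
    ring

lemma jm_mul_of_absorb (hQ : Q ≠ 0) {y : A} {m : ℕ} (hy : ∀ i < m, h i * y = Q • y) :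
    jm Q h m * y = (Q * qNum Q m) • y := by
  rw [jm, Finset.sum_mul, qNum, Finset.mul_sum, Finset.sum_smul]
  refine Finset.sum_congr rfl fun k hk => ?_
  rw [Finset.mem_range] at hk
  rw [smul_mul_assoc, palin_mul_of_absorb k _ fun i hi => hy i (by omega), smul_smul]
  congr 1
  field_simp
  ring

/-- Each factor of the symmetrizer acts by `1`, because `Q [k] + 1 = [k + 1]`. The module form also
serves for a joint eigenvector whose first contents are those of a single row. -/
lemma sym_smul_of_jm_smul {M : Type*} [AddCommGroup M] [Module A M] [Module K M]
    [IsScalarTower K A M] (hq : ∀ k, qNum Q (k + 1) ≠ 0) {y : M} {m : ℕ}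
    (hy : ∀ k ≤ m, jm Q h k • y = (Q * qNum Q k) • y) : sym Q h m • y = y := by
  induction m with
  | zero => simp [sym]
  | succ m ih =>
    have e : (Q * qNum Q (m + 1)) • y + y = qNum Q (m + 2) • y := by
      rw [qNum_succ' Q (m + 1), add_smul, one_smul]
    rw [sym, smul_assoc, mul_smul, add_smul, hy (m + 1) le_rfl, one_smul, e, smul_comm,
      smul_smul (qNum Q (m + 2))⁻¹, inv_mul_cancel₀ (hq _), one_smul,
      ih fun k hk => hy k (by omega)]

lemma sym_mul_of_absorb (hQ : Q ≠ 0) (hq : ∀ k, qNum Q (k + 1) ≠ 0) {y : A} {m : ℕ}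
    (hy : ∀ i < m, h i * y = Q • y) : sym Q h m * y = y :=
  show sym Q h m • y = y from
    sym_smul_of_jm_smul hq fun _ hk => jm_mul_of_absorb hQ fun i hi => hy i (by omega)

lemma mul_sym_of_absorb (H : HeckeSystem Q N h) (hQ : Q ≠ 0) (hq : ∀ k, qNum Q (k + 1) ≠ 0)
    {y : A} {m : ℕ} (hm : m ≤ N) (hy : ∀ i < m, y * h i = Q • y) : y * sym Q h m = y := by
  have := sym_mul_of_absorb (h := fun t => MulOpposite.op (h t)) (y := MulOpposite.op y) hQ hq
    (m := m) (fun i hi => by simpa using congrArg MulOpposite.op (hy i hi))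
  rw [← H.op_sym hQ hm] at this
  simpa using congrArg MulOpposite.unop this

lemma sym_mul_sym (H : HeckeSystem Q N h) (hQ : Q ≠ 0) (hq : ∀ k, qNum Q (k + 1) ≠ 0)
    {m : ℕ} (hm : m ≤ N) : sym Q h m * sym Q h m = sym Q h m :=
  sym_mul_of_absorb hQ hq (H.gen_mul_sym hQ hm)

lemma desc_mul_of_absorb {y : A} {m : ℕ} (k : ℕ) (hk : k ≤ m)
    (hy : ∀ i, i < m → m ≤ i + k → h i * y = Q • y) :
    desc h m (k + 1) * y = Q ^ k • (h m * y) := by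
  induction k with
  | zero => simp [desc]
  | succ k ih =>
    rw [desc, mul_assoc, hy _ (by omega) (by omega), mul_smul_comm,
      ih (by omega) (fun i hi hik => hy i hi (by omega)), smul_smul, pow_succ']

lemma sum_mul_desc_mul {x y : A} {m n : ℕ} (hn : n ≤ m + 1)
    (hy : ∀ i, i < m → m < i + n → h i * y = Q • y) :
    (∑ k ∈ Finset.range (n + 1), x * desc h m k) * y =
      x * y + qNum Q n • (x * h m * y) := by
  rw [Finset.sum_mul, Finset.sum_range_succ', add_comm, qNum, Finset.sum_smul]
  congr 1
  · simp [desc]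
  · refine Finset.sum_congr rfl fun k hk => ?_
    rw [Finset.mem_range] at hk
    rw [mul_assoc, desc_mul_of_absorb k (by omega) fun i hi hik => hy i hi (by omega),
      mul_smul_comm, mul_assoc]

/-- Insert `sym Q h m` on the right, which the larger symmetrizer absorbs. It then swallows all but
the first letter of every nonempty descending word. -/
lemma sym_succ_eq (H : HeckeSystem Q N h) (hQ : Q ≠ 0) (hq : ∀ k, qNum Q (k + 1) ≠ 0)
    {m : ℕ} (hm : m < N) :
    sym Q h (m + 1) = (qNum Q (m + 2))⁻¹ •
      (sym Q h m + qNum Q (m + 1) • (sym Q h m * h m * sym Q h m)) := by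
  have e := H.mul_sym_of_absorb hQ hq (m := m) (by omega)
    (fun i hi => H.sym_mul_gen hQ (m := m + 1) (by omega) i (by omega))
  rw [← e, sym, mul_jm_of_absorb hQ (H.sym_mul_gen hQ (by omega)), smul_mul_assoc,
    sum_mul_desc_mul le_rfl fun i hi _ => H.gen_mul_sym hQ (by omega) i hi,
    H.sym_mul_sym hQ hq (by omega)]

lemma desc_shift (m k : ℕ) (hk : k ≤ m + 1) :
    desc (fun t => h (t + 1)) m k = desc h (m + 1) k := by
  induction k with
  | zero => rfl
  | succ k ih =>
    rw [desc, desc, ih (by omega), show m - k + 1 = m + 1 - k by omega]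

/-- Same expansion as for `sym Q h (m + 2)`, but the shifted system has no word reaching down to `h
0`. One term fewer gives `qNum Q (m + 1)` in place of `qNum Q (m + 2)`. -/
lemma sym_mul_sym_shift_mul_sym (H : HeckeSystem Q N h) (hQ : Q ≠ 0)
    (hq : ∀ k, qNum Q (k + 1) ≠ 0) {m : ℕ} (hm : m + 1 < N) :
    sym Q h (m + 1) * sym Q (fun t => h (t + 1)) (m + 1) * sym Q h (m + 1) =
      (qNum Q (m + 2))⁻¹ • (sym Q h (m + 1) +
        qNum Q (m + 1) • (sym Q h (m + 1) * h (m + 1) * sym Q h (m + 1))) := by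
  have H' : HeckeSystem Q (N - 1) fun t => h (t + 1) := H.shift (by omega)
  have e : sym Q h (m + 1) * sym Q (fun t => h (t + 1)) m = sym Q h (m + 1) :=
    H'.mul_sym_of_absorb hQ hq (by omega) fun i hi =>
      H.sym_mul_gen hQ (by omega) (i + 1) (by omega)
  rw [sym.eq_def Q (fun t => h (t + 1))]
  simp only [mul_smul_comm, smul_mul_assoc]
  rw [← mul_assoc, e, mul_jm_of_absorb hQ fun i hi =>
    H.sym_mul_gen hQ (by omega) (i + 1) (by omega)]
  have e2 : ∀ k ∈ Finset.range (m + 2), sym Q h (m + 1) * desc (fun t => h (t + 1)) m k =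
      sym Q h (m + 1) * desc h (m + 1) k := fun k hk => by
    rw [desc_shift m k (by simp at hk; omega)]
  rw [Finset.sum_congr rfl e2, sum_mul_desc_mul (by omega) fun i hi _ =>
    H.gen_mul_sym hQ (by omega) i hi, H.sym_mul_sym hQ hq (by omega)]

/-- Both symmetrizers absorb the same set of generators on both sides, so their product equals each
of them. -/
lemma sym_reverse (H : HeckeSystem Q N h) (hQ : Q ≠ 0) (hq : ∀ k, qNum Q (k + 1) ≠ 0)
    {h' : ℕ → A} (H' : ∀ i < N, h' i = h (N - 1 - i)) : sym Q h' N = sym Q h N := by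
  have R := H.reverse H'
  have e1 : sym Q h N * sym Q h' N = sym Q h' N := sym_mul_of_absorb hQ hq fun i hi => by
    have := R.gen_mul_sym hQ le_rfl (N - 1 - i) (by omega)
    rwa [H' _ (by omega), show N - 1 - (N - 1 - i) = i by omega] at this
  have e2 : sym Q h N * sym Q h' N = sym Q h N := R.mul_sym_of_absorb hQ hq le_rfl fun i hi => by
    rw [H' i hi]
    exact H.sym_mul_gen hQ le_rfl _ (by omega)
  rw [← e1, e2]

lemma sym_reverse_of_succ (H : HeckeSystem Q N h) (hQ : Q ≠ 0) (hq : ∀ k, qNum Q (k + 1) ≠ 0)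
    {m : ℕ} (hm : m < N) :
    sym Q (fun t => h (m - t)) m = sym Q (fun t => h (t + 1)) m :=
  (H.shift (M := m) (c := 1) (by omega)).sym_reverse hQ hq fun i hi => by congr 1; omega

/-- A symmetrizer is, up to a scalar, `e e' e - e` for the rescaled symmetrizers `e`, `e'` with one
generator less. -/
lemma smul_sym_succ_eq (H : HeckeSystem Q N h) (hQ : Q ≠ 0) (hq : ∀ k, qNum Q (k + 1) ≠ 0)
    {r : K} (hr : r ^ 2 * Q = 1) {m : ℕ} (hm : m + 1 < N) {e e' : A}
    (he : e = (r ^ (m + 1) * qNum Q (m + 2)) • sym Q h (m + 1))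
    (he' : e' = (r ^ (m + 1) * qNum Q (m + 2)) • sym Q (fun t => h (t + 1)) (m + 1)) :
    e * e' * e - e = ((r ^ m * qNum Q (m + 1)) * (r ^ (m + 1) * qNum Q (m + 2))) •
      (r ^ (m + 2) * qNum Q (m + 3)) • sym Q h (m + 2) := by
  have h1 := hq m
  have h2 := hq (m + 1)
  have h3 := hq (m + 2)
  have hp : r ^ (m + 1) * r ^ (m + 1) * Q ^ (m + 1) = 1 := by
    rw [← mul_pow, ← mul_pow, ← pow_two, hr, one_pow]
  rw [he, he']
  simp only [mul_smul_comm, smul_mul_assoc]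
  rw [H.sym_mul_sym_shift_mul_sym hQ hq hm, H.sym_succ_eq hQ hq hm]
  -- The subtracted `e` turns `r^(2(m+1)) [m+2] - 1` into `r^(2(m+1)) [m+1]`, since `[m+2] = [m+1] +
  -- Q^(m+1)` and `r^2 Q = 1`.
  have hs := qNum_succ Q (m + 1)
  match_scalars
  · field_simp
    linear_combination r ^ (m + 1) * (r ^ (m + 1) * r ^ (m + 1) * hs + hp)
  · field_simp
    ring

/-- Reversing the `m + 2` generators exchanges `e` and `e'` and fixes the larger symmetrizer to
which both sides are proportional. -/
lemma braid_sub_eq (H : HeckeSystem Q N h) (hQ : Q ≠ 0) (hq : ∀ k, qNum Q (k + 1) ≠ 0)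
    {r : K} (hr : r ^ 2 * Q = 1) {m : ℕ} (hm : m + 1 < N) {e e' : A}
    (he : e = (r ^ (m + 1) * qNum Q (m + 2)) • sym Q h (m + 1))
    (he' : e' = (r ^ (m + 1) * qNum Q (m + 2)) • sym Q (fun t => h (t + 1)) (m + 1)) :
    e * e' * e - e = e' * e * e' - e' := by
  have H₁ := H.mono (M := m + 2) (by omega)
  have H₂ : HeckeSystem Q (m + 2) fun t => h (m + 1 - t) :=
    H₁.reverse fun i hi => by congr 1
  have e1 : sym Q (fun t => h (m + 1 - t)) (m + 1) = sym Q (fun t => h (t + 1)) (m + 1) :=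
    H.sym_reverse_of_succ hQ hq (by omega)
  have e2 : sym Q (fun t => (fun t => h (m + 1 - t)) (t + 1)) (m + 1) = sym Q h (m + 1) :=
    (H.mono (M := m + 1) (by omega)).sym_reverse hQ hq fun i hi => by
      dsimp only; congr 1; omega
  have e3 : sym Q (fun t => h (m + 1 - t)) (m + 2) = sym Q h (m + 2) :=
    H₁.sym_reverse hQ hq fun i hi => by congr 1
  rw [H.smul_sym_succ_eq hQ hq hr hm he he', ← e3]
  rw [← e1] at he'
  rw [← e2] at he
  exact (H₂.smul_sym_succ_eq hQ hq hr (by omega) he' he).symm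

end HeckeSystem

end HeckeSystem

/-! ### Combinatorics of weights: the greedy row-reading tableau. -/

section WeightLists

/-- The contents of the first `m` boxes of the row `k` of a Young diagram. -/
def rowList (k m : ℕ) : List ℤ := (List.range m).map fun i : ℕ => (i : ℤ) - k

lemma rowList_add (k m m' : ℕ) :
    rowList k (m + m') = rowList k m ++ (List.range m').map fun i : ℕ => ((m + i : ℕ) : ℤ) - k := by
  simp [rowList, List.range_add, Function.comp_def]

lemma rowList_succ (k m : ℕ) : rowList k (m + 1) = rowList k m ++ [(m : ℤ) - k] := by
  simp [rowList_add]

lemma mem_rowList {k m : ℕ} {c : ℤ} (hc : c ∈ rowList k m) : -k ≤ c ∧ c < m - k := by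
  simp only [rowList, List.mem_map, List.mem_range] at hc
  omega

@[simp] lemma length_rowList (k m : ℕ) : (rowList k m).length = m := by simp [rowList]

/-- The combinatorial properties of the set of joint eigenvalues of the Jucys-Murphy elements. -/
structure WeightSystem (n : ℕ) (P : List ℤ → Prop) : Prop where
  left : ∀ s t, P (s ++ t) → P s
  exists_append : ∀ s, P s → s.length < n → ∃ b, P (s ++ [b])
  head : ∀ b, P [b] → b = 0
  swap : ∀ s t a b, 1 < |a - b| → P (s ++ a :: b :: t) → P (s ++ b :: a :: t)
  not_repeat : ∀ s a, ¬P (s ++ [a, a])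
  not_braid : ∀ s a b, |a - b| = 1 → ¬P (s ++ [a, b, a])

namespace WeightSystem

variable {n : ℕ} {P : List ℤ → Prop}

lemma move_left (W : WeightSystem n P) {b : ℤ} {r : List ℤ} (t : List ℤ) : ∀ u,
    (∀ c ∈ t, 1 < |c - b|) → P (u ++ t ++ b :: r) → P (u ++ b :: (t ++ r)) := by
  induction t with
  | nil => intro u _ h; simpa using h
  | cons c t ih =>
    intro u ht h
    have := ih (u ++ [c]) (fun d hd => ht d (by simp [hd])) (by simpa using h)
    exact W.swap _ _ _ _ (ht c (by simp)) (by simpa using this)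

lemma move_right (W : WeightSystem n P) {b : ℤ} {r : List ℤ} (t : List ℤ) : ∀ u,
    (∀ c ∈ t, 1 < |b - c|) → P (u ++ b :: (t ++ r)) → P (u ++ t ++ b :: r) := by
  induction t with
  | nil => intro u _ h; simpa using h
  | cons c t ih =>
    intro u ht h
    have := ih (u ++ [c]) (fun d hd => ht d (by simp [hd]))
      (by simpa using W.swap u _ _ _ (ht c (by simp)) h)
    simpa using this

/-- An entry far from all earlier ones can be swapped to the front, where only `0` is allowed. -/
lemma head_append (W : WeightSystem n P) {s : List ℤ} {b : ℤ} (hb : ∀ c ∈ s, 1 < |c - b|)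
    (h : P (s ++ [b])) : b = 0 :=
  W.head b (W.left [b] s (by simpa using W.move_left s [] hb (r := []) (by simpa using h)))

lemma exists_max_append (W : WeightSystem n P) {s : List ℤ} (hs : P s) (hn : s.length < n) :
    ∃ b, P (s ++ [b]) ∧ ∀ c, b < c → ¬P (s ++ [c]) := by
  obtain ⟨B, hB⟩ : ∃ B : ℤ, ∀ c ∈ s, c ≤ B := by
    obtain ⟨B, hB⟩ := s.toFinset.bddAbove
    exact ⟨B, fun c hc => hB (by simpa using hc)⟩
  obtain ⟨b, hb, hmax⟩ := Int.exists_greatest_of_bdd (P := fun b => P (s ++ [b]))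
    ⟨max (B + 1) 0, fun z hz => by
      by_contra hlt
      have h0 := W.head_append (fun c hc => by
        have := hB c hc
        rw [lt_abs]
        right
        omega) hz
      omega⟩ (W.exists_append s hs hn)
  exact ⟨b, hb, fun c hc hP => absurd (hmax c hP) (by omega)⟩

/-- The next entry after a row-reading list that is greedy at its last position. -/
lemma next_content (W : WeightSystem n P) {pre : List ℤ} {k m : ℕ} {b : ℤ}
    (hpre : k = 0 ∧ pre = [] ∨ ∃ u k' M, k = k' + 1 ∧ m ≤ M ∧ (∀ c ∈ u, 1 - (k' : ℤ) ≤ c) ∧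
      pre = u ++ rowList k' (M + 1))
    (hmax : ∀ c, (m : ℤ) - k < c → ¬P (pre ++ rowList k m ++ [c]))
    (h : P (pre ++ rowList k (m + 1) ++ [b])) :
    b = m + 1 - k ∧ (∀ u k', k = k' + 1 → pre ≠ u ++ rowList k' (m + 1)) ∨ b = -k - 1 := by
  have hge : ∀ c ∈ pre ++ rowList k (m + 1), -(k : ℤ) ≤ c := by
    intro c hc
    rcases List.mem_append.1 hc with hcp | hcp
    · rcases hpre with ⟨_, rfl⟩ | ⟨u, k', M, rfl, _, hu, rfl⟩
      · simp at hcp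
      · rcases List.mem_append.1 hcp with hcu | hcu
        · have := hu c hcu
          push_cast
          omega
        · have := (mem_rowList hcu).1
          push_cast
          omega
    · exact (mem_rowList hcp).1
  rcases lt_trichotomy b (-k - 1) with hb | hb | hb
  -- A content below `-k - 1` is far from everything before it.
  · have := W.head_append (fun c hc => by
      have := hge c hc
      rw [lt_abs]
      left
      omega) h
    omega
  · exact Or.inr hb
  left
  have h' : P (pre ++ rowList k m ++ ((m : ℤ) - k) :: b :: []) := by
    simpa [rowList_succ] using h
  rcases lt_trichotomy b (m - k) with hlt | heq | hgt
  -- The content `b` already occurs in the current row. Moving the new copy left until it follows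
  -- `b, b + 1` creates the forbidden pattern `b, b + 1, b`.
  · exfalso
    obtain ⟨i, rfl⟩ : ∃ i : ℕ, b = i - k := ⟨(b + k).toNat, by omega⟩
    obtain ⟨j, rfl⟩ : ∃ j, m = i + 1 + j := ⟨m - (i + 1), by omega⟩
    set t := (List.range j).map fun t : ℕ => ((i + 1 + 1 + t : ℕ) : ℤ) - k with ht
    have e : rowList k (i + 1 + j + 1) =
        rowList k i ++ [(i : ℤ) - k, (i : ℤ) - k + 1] ++ t := by
      rw [show i + 1 + j + 1 = i + 1 + 1 + j by ring, rowList_add, rowList_succ, rowList_succ]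
      simp [ht]
      ring
    have h2 : P ((pre ++ rowList k i ++ [(i : ℤ) - k, (i : ℤ) - k + 1]) ++ t ++
        ((i : ℤ) - k) :: []) := by
      rw [e] at h
      simpa using h
    have h3 := W.move_left t _ (fun c hc => by
      simp only [ht, List.mem_map, List.mem_range] at hc
      obtain ⟨x, _, rfl⟩ := hc
      rw [lt_abs]
      left
      push_cast
      omega) h2
    refine W.not_braid (pre ++ rowList k i) ((i : ℤ) - k) ((i : ℤ) - k + 1) (by simp) ?_
    exact W.left _ t (by simpa using h3)
  · rw [heq] at h'
    exact absurd h' (W.not_repeat _ _)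
  · rcases (show b = m + 1 - k ∨ (m : ℤ) + 1 - k < b by omega) with rfl | hgt
    · refine ⟨rfl, ?_⟩
      -- If the row above has the same length, its last entry moves right past the first `m` entries
      -- of the current row, and a forbidden pattern `c, c - 1, c` appears.
      rintro u k' rfl rfl
      rw [rowList_succ] at h'
      push_cast at h'
      have h2 := W.move_right (rowList (k' + 1) m) (u ++ rowList k' m)
        (b := (m : ℤ) - k') (r := [(m : ℤ) - k' - 1, (m : ℤ) - k'])
        (fun c hc => by
          have := (mem_rowList hc).2
          rw [lt_abs]
          left
          push_cast at this
          omega)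
        (by
          rw [show (m : ℤ) - (k' + 1) = m - k' - 1 by ring,
            show (m : ℤ) + 1 - (k' + 1) = m - k' by ring] at h'
          simpa using h')
      exact W.not_braid _ _ _ (by simp) h2
    -- A larger jump could be swapped with the last entry, contradicting the greedy choice there.
    · refine absurd (W.left _ [(m : ℤ) - k] ?_) (hmax b (by omega))
      simpa using W.swap _ _ _ _ (by rw [lt_abs]; right; omega) h'

end WeightSystem

/-- The Young diagram with one more box. -/
def YoungDiagram.addCell (μ : YoungDiagram) (c : ℕ × ℕ)
    (h : ∀ d : ℕ × ℕ, d ≤ c → d ≠ c → d ∈ μ) : YoungDiagram where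
  cells := insert c μ.cells
  isLowerSet := by
    intro a b hba ha
    simp only [Finset.coe_insert, Set.mem_insert_iff, Finset.mem_coe, YoungDiagram.mem_cells]
      at ha ⊢
    rcases ha with rfl | ha
    · by_cases e : b = a
      · exact Or.inl e
      · exact Or.inr (h b hba e)
    · exact Or.inr (μ.isLowerSet hba ha)

lemma YoungDiagram.mem_addCell {μ : YoungDiagram} {c : ℕ × ℕ} {h} {d : ℕ × ℕ} :
    d ∈ μ.addCell c h ↔ d = c ∨ d ∈ μ := by
  rw [← YoungDiagram.mem_cells, ← YoungDiagram.mem_cells, addCell]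
  simp

/-- A chain of Young diagrams of sizes `0, …, p` in which the contents of the boxes added are the
entries of `s`. -/
structure IsContentChain (p : ℕ) (Γ : ℕ → YoungDiagram) (s : List ℤ) : Prop where
  card : ∀ i ≤ p, (Γ i).card = i
  le : ∀ i < p, Γ i ≤ Γ (i + 1)
  content : ∀ i < p, ∀ b ∈ (Γ (i + 1)).cells \ (Γ i).cells, s[i]? = some ((b.2 : ℤ) - b.1)

lemma IsContentChain.extend {p : ℕ} {Γ : ℕ → YoungDiagram} {s : List ℤ}
    (H : IsContentChain p Γ s) (hs : s.length = p) (c : ℕ × ℕ) (hc : c ∉ Γ p)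
    (h : ∀ d : ℕ × ℕ, d ≤ c → d ≠ c → d ∈ Γ p) :
    IsContentChain (p + 1) (Function.update Γ (p + 1) ((Γ p).addCell c h))
      (s ++ [(c.2 : ℤ) - c.1]) := by
  have e : ∀ i ≤ p, Function.update Γ (p + 1) ((Γ p).addCell c h) i = Γ i := fun i hi => by
    rw [Function.update_of_ne (by omega)]
  refine ⟨fun i hi => ?_, fun i hi => ?_, fun i hi b hb => ?_⟩
  · rcases Nat.eq_or_lt_of_le hi with rfl | hlt
    · rw [Function.update_self, YoungDiagram.card]
      change (insert c (Γ p).cells).card = _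
      rw [Finset.card_insert_of_notMem (by simpa using hc)]
      congr 1
      exact H.card p le_rfl
    · rw [e i (by omega)]
      exact H.card i (by omega)
  · rcases Nat.eq_or_lt_of_le (Nat.le_of_lt_succ hi) with rfl | hlt
    · rw [Function.update_self, e i le_rfl]
      intro d hd
      exact YoungDiagram.mem_addCell.2 (Or.inr hd)
    · rw [e i (by omega), e (i + 1) (by omega)]
      exact H.le i hlt
  · rcases Nat.eq_or_lt_of_le (Nat.le_of_lt_succ hi) with rfl | hlt
    · rw [Function.update_self, e i le_rfl] at hb
      simp only [Finset.mem_sdiff, YoungDiagram.mem_cells, YoungDiagram.mem_addCell] at hb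
      rcases hb.1 with rfl | h'
      · simp [← hs]
      · exact absurd h' hb.2
    · rw [e i (by omega), e (i + 1) (by omega)] at hb
      rw [List.getElem?_append_left (by omega)]
      exact H.content i hlt b hb

/-- A weight whose entries are the contents of a Young diagram read row by row, the last row being
`k` with `m + 1` boxes, and the last entry being the largest possible one. -/
structure GreedyChain (P : List ℤ → Prop) (p : ℕ) (Γ : ℕ → YoungDiagram) (pre : List ℤ)
    (k m r : ℕ) : Prop where
  weight : P (pre ++ rowList k (m + 1))
  length : (pre ++ rowList k (m + 1)).length = p
  chain : IsContentChain p Γ (pre ++ rowList k (m + 1))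
  max : ∀ c, (m : ℤ) - k < c → ¬P (pre ++ rowList k m ++ [c])
  row_le : ∀ c ∈ Γ p, c.1 ≤ k
  mem_last : ∀ j, (k, j) ∈ Γ p ↔ j < m + 1
  first : ∀ j, (0, j) ∈ Γ p ↔ j < r
  first_prefix : rowList 0 r <+: pre ++ rowList k (m + 1)
  pre_eq : k = 0 ∧ pre = [] ∨ ∃ u k' M, k = k' + 1 ∧ m ≤ M ∧ (∀ c ∈ u, 1 - (k' : ℤ) ≤ c) ∧
    pre = u ++ rowList k' (M + 1) ∧ ∀ j, (k', j) ∈ Γ p ↔ j < M + 1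

@[simp] lemma YoungDiagram.rowLen_bot (i : ℕ) : (⊥ : YoungDiagram).rowLen i = 0 := by
  by_contra h
  have := YoungDiagram.mem_iff_lt_rowLen.2 (Nat.pos_of_ne_zero h)
  simp at this

lemma WeightSystem.exists_greedyChain {n : ℕ} {P : List ℤ → Prop} (W : WeightSystem n P)
    (h0 : P []) {p : ℕ} (hp : p < n) : ∃ Γ pre k m r, GreedyChain P (p + 1) Γ pre k m r := by
  induction p with
  | zero =>
    obtain ⟨b, hb, hmax⟩ := W.exists_max_append h0 hp
    obtain rfl : b = 0 := W.head b hb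
    have C : IsContentChain 0 (fun _ => ⊥) [] := ⟨by simp, by simp, by simp⟩
    have h : ∀ d : ℕ × ℕ, d ≤ (0, 0) → d ≠ (0, 0) → d ∈ (⊥ : YoungDiagram) := by
      intro d hd hne
      exact absurd (le_antisymm hd (by simp [Prod.le_def])) hne
    have C' := C.extend rfl (0, 0) (by simp) h
    refine ⟨_, [], 0, 0, 1, ?_, ?_, C', ?_, ?_, ?_, ?_, ?_, Or.inl ⟨rfl, rfl⟩⟩
    · simpa [rowList] using hb
    · simp
    · intro c hc
      simpa [rowList] using hmax c (by simpa using hc)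
    · intro c hc
      rw [Function.update_self, YoungDiagram.mem_addCell] at hc
      rcases hc with rfl | hc
      · rfl
      · simp at hc
    · intro j
      rw [Function.update_self, YoungDiagram.mem_addCell]
      simp
    · intro j
      rw [Function.update_self, YoungDiagram.mem_addCell]
      simp
    · simp
  | succ p ih =>
    obtain ⟨Γ, pre, k, m, r, G⟩ := ih (by omega)
    obtain ⟨b, hb, hmax⟩ := W.exists_max_append G.weight (by rw [G.length]; omega)
    have hpre : k = 0 ∧ pre = [] ∨ ∃ u k' M, k = k' + 1 ∧ m ≤ M ∧ (∀ c ∈ u, 1 - (k' : ℤ) ≤ c) ∧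
        pre = u ++ rowList k' (M + 1) := by
      rcases G.pre_eq with h | ⟨u, k', M, h1, h2, h3, h4, _⟩
      exacts [Or.inl h, Or.inr ⟨u, k', M, h1, h2, h3, h4⟩]
    have lower : ∀ {i j i' j' : ℕ}, (i, j) ∈ Γ (p + 1) → i' ≤ i → j' ≤ j → (i', j') ∈ Γ (p + 1) :=
      fun h hi hj => (Γ (p + 1)).up_left_mem hi hj h
    rcases W.next_content hpre G.max hb with ⟨hbm, hrow⟩ | hbm
    · have hnot : (k, m + 1) ∉ Γ (p + 1) := by rw [G.mem_last]; omega
      -- The row above is at least as long, and equality was excluded, so the box above the new one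
      -- is present.
      have hM : ∀ k', k = k' + 1 → (k', m + 1) ∈ Γ (p + 1) := by
        rintro k' rfl
        rcases G.pre_eq with ⟨h, _⟩ | ⟨u, k'', M, h1, h2, h3, h4, h5⟩
        · omega
        · obtain rfl : k' = k'' := by omega
          rw [h5]
          rcases Nat.eq_or_lt_of_le h2 with rfl | hlt
          · exact absurd h4 (hrow u k' rfl)
          · omega
      have h : ∀ d : ℕ × ℕ, d ≤ (k, m + 1) → d ≠ (k, m + 1) → d ∈ Γ (p + 1) := by
        rintro ⟨i, j⟩ hd hne
        rw [Prod.mk_le_mk] at hd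
        rcases Nat.eq_or_lt_of_le hd.1 with rfl | hlt
        · rw [G.mem_last]
          have : j ≠ m + 1 := fun e => hne (by rw [e])
          omega
        · exact lower (hM (k - 1) (by omega)) (by omega) hd.2
      have C' := G.chain.extend G.length (k, m + 1) hnot h
      have eb : ((m + 1 : ℕ) : ℤ) - k = b := by rw [hbm]; push_cast; ring
      have es : pre ++ rowList k (m + 1) ++ [b] = pre ++ rowList k (m + 1 + 1) := by
        rw [rowList_succ k (m + 1), eb, List.append_assoc]
      rw [eb, es] at C'
      have e0 : k = 0 → r = m + 1 := by
        rintro rfl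
        have h1 := G.first r
        have h2 := G.first (m + 1)
        have h3 := G.first m
        rw [G.mem_last] at h1 h2 h3
        omega
      refine ⟨_, pre, k, m + 1, if k = 0 then r + 1 else r, es ▸ hb, ?_, C', ?_, ?_, ?_, ?_, ?_, ?_⟩
      · rw [← es, List.length_append, G.length]
        rfl
      · intro c hc
        exact hmax c (by rw [← eb]; exact hc)
      · intro c hc
        rw [Function.update_self, YoungDiagram.mem_addCell] at hc
        rcases hc with rfl | hc
        exacts [le_rfl, G.row_le c hc]
      · intro j
        rw [Function.update_self, YoungDiagram.mem_addCell, G.mem_last, Prod.mk.injEq]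
        omega
      · intro j
        rw [Function.update_self, YoungDiagram.mem_addCell, G.first, Prod.mk.injEq]
        split_ifs with hk
        · have := e0 hk
          omega
        · omega
      · split_ifs with hk
        · subst hk
          rw [e0 rfl]
          rcases G.pre_eq with ⟨_, rfl⟩ | ⟨u, k', M, h1, _⟩
          · simp
          · omega
        · rw [← es]
          exact G.first_prefix.trans (List.prefix_append _ _)
      · rcases G.pre_eq with h | ⟨u, k', M, rfl, h2, h3, h4, h5⟩
        · exact Or.inl h
        · have := (h5 (m + 1)).1 (hM k' rfl)
          refine Or.inr ⟨u, k', M, rfl, by omega, h3, h4, fun j => ?_⟩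
          rw [Function.update_self, YoungDiagram.mem_addCell, h5, Prod.mk.injEq]
          omega
    · have hnot : (k + 1, 0) ∉ Γ (p + 1) := fun hmem => by
        have := G.row_le _ hmem
        simp at this
      have h : ∀ d : ℕ × ℕ, d ≤ (k + 1, 0) → d ≠ (k + 1, 0) → d ∈ Γ (p + 1) := by
        rintro ⟨i, j⟩ hd hne
        rw [Prod.mk_le_mk] at hd
        obtain rfl : j = 0 := by omega
        have : i ≠ k + 1 := fun e => hne (by rw [e])
        exact lower ((G.mem_last 0).2 (by omega)) (by omega : i ≤ k) le_rfl
      have C' := G.chain.extend G.length (k + 1, 0) hnot h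
      have eb : ((0 : ℕ) : ℤ) - (k + 1 : ℕ) = b := by rw [hbm]; push_cast; ring
      have es : rowList (k + 1) (0 + 1) = [b] := by rw [← eb]; simp [rowList]
      rw [eb, ← es] at C'
      refine ⟨_, pre ++ rowList k (m + 1), k + 1, 0, r, es ▸ hb, ?_, C', ?_, ?_, ?_, ?_, ?_, ?_⟩
      · rw [List.length_append, G.length]
        simp
      · intro c hc
        have := hmax c (by rw [← eb]; exact hc)
        simpa [rowList] using this
      · intro c hc
        rw [Function.update_self, YoungDiagram.mem_addCell] at hc
        rcases hc with rfl | hc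
        exacts [le_rfl, (G.row_le c hc).trans (Nat.le_succ k)]
      · intro j
        rw [Function.update_self, YoungDiagram.mem_addCell, Prod.mk.injEq]
        constructor
        · rintro (h | h)
          · omega
          · have := G.row_le _ h
            simp at this
        · intro hj
          left
          omega
      · intro j
        rw [Function.update_self, YoungDiagram.mem_addCell, G.first, Prod.mk.injEq]
        omega
      · exact G.first_prefix.trans (List.prefix_append _ _)
      · refine Or.inr ⟨pre, k, m, rfl, by omega, fun c hc => ?_, rfl, fun j => ?_⟩
        · rcases hpre with ⟨_, rfl⟩ | ⟨u, k', M, rfl, _, hu, rfl⟩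
          · simp at hc
          · rcases List.mem_append.1 hc with hc | hc
            · have := hu c hc
              push_cast
              omega
            · have := (mem_rowList hc).1
              push_cast
              omega
        · rw [Function.update_self, YoungDiagram.mem_addCell, G.mem_last, Prod.mk.injEq]
          omega

/-- A weight system contains the contents of a row-reading standard tableau. -/
lemma WeightSystem.exists_chain {n : ℕ} {P : List ℤ → Prop} (W : WeightSystem n P) (h0 : P []) :
    ∃ (s : List ℤ) (Γ : ℕ → YoungDiagram), P s ∧ s.length = n ∧ IsContentChain n Γ s ∧
      rowList 0 ((Γ n).rowLen 0) <+: s := by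
  rcases n with _ | n
  · refine ⟨[], fun _ => ⊥, h0, rfl, ⟨by simp, by simp, by simp⟩, ?_⟩
    simp [rowList]
  · obtain ⟨Γ, pre, k, m, r, G⟩ := W.exists_greedyChain h0 (Nat.lt_succ_self n)
    refine ⟨_, Γ, G.weight, G.length, G.chain, ?_⟩
    have : (Γ (n + 1)).rowLen 0 = r := by
      have h1 := G.first r
      have h2 := G.first ((Γ (n + 1)).rowLen 0)
      rw [YoungDiagram.mem_iff_lt_rowLen] at h1 h2
      omega
    rw [this]
    exact G.first_prefix

end WeightLists

/-! ### Quantum integers and eigenvalues attached to contents. -/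

section QuantumIntegers

lemma qNum_ofReal (q : ℝ) (k : ℕ) : qNum (q : ℂ) k = ((qNum q k : ℝ) : ℂ) := by
  simp [qNum]

lemma qNum_pos {q : ℝ} (hq : 0 < q) (k : ℕ) : 0 < qNum q (k + 1) :=
  Finset.sum_pos (fun _ _ => pow_pos hq _) ⟨0, by simp⟩

lemma qNum_ne_zero {q : ℝ} (hq : 0 < q) (k : ℕ) : qNum (q : ℂ) (k + 1) ≠ 0 := by
  rw [qNum_ofReal]
  exact_mod_cast (qNum_pos hq k).ne'

lemma qInt_add_one {q : ℝ} (hq : 0 < q) (c : ℤ) : qInt q (c + 1) = q * qInt q c + 1 := by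
  unfold qInt
  split_ifs with h
  · simp [h]
  · have : q - 1 ≠ 0 := sub_ne_zero.2 h
    rw [zpow_add_one₀ hq.ne']
    field_simp
    ring

lemma one_add_mul_qInt (q : ℝ) (c : ℤ) : 1 + (q - 1) * qInt q c = q ^ c := by
  unfold qInt
  split_ifs with h
  · simp [h]
  · have : q - 1 ≠ 0 := sub_ne_zero.2 h
    field_simp
    ring

lemma qInt_zero (q : ℝ) : qInt q 0 = 0 := by simp [qInt]

lemma qInt_natCast {q : ℝ} (hq : 0 < q) (k : ℕ) : qInt q (k : ℤ) = qNum q k := by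
  induction k with
  | zero => simp [qInt_zero, qNum]
  | succ k ih => rw [Nat.cast_succ, qInt_add_one hq, ih, qNum_succ']

lemma qInt_strictMono {q : ℝ} (hq : 0 < q) : StrictMono (qInt q) := by
  refine strictMono_int_of_lt_succ fun c => ?_
  have h1 := one_add_mul_qInt q c
  have h2 := zpow_pos hq c
  rw [qInt_add_one hq]
  linarith

/-- The eigenvalue `q [c]_q` of a Jucys-Murphy element that belongs to the content `c`. -/
noncomputable def contentValue (q : ℝ) (c : ℤ) : ℂ := ((q * qInt q c : ℝ) : ℂ)

lemma contentValue_injective {q : ℝ} (hq : 0 < q) : Function.Injective (contentValue q) := by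
  intro a b h
  have : q * qInt q a = q * qInt q b := Complex.ofReal_injective h
  exact (qInt_strictMono hq).injective (mul_left_cancel₀ hq.ne' this)

lemma contentValue_zero (q : ℝ) : contentValue q 0 = 0 := by simp [contentValue, qInt_zero]

lemma contentValue_add_one {q : ℝ} (hq : 0 < q) (c : ℤ) :
    contentValue q (c + 1) = q * (contentValue q c + 1) := by
  simp [contentValue, qInt_add_one hq]

lemma conj_contentValue (q : ℝ) (c : ℤ) :
    (starRingEnd ℂ) (contentValue q c) = contentValue q c :=
  Complex.conj_ofReal _

lemma contentValue_natCast {q : ℝ} (hq : 0 < q) (k : ℕ) :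
    contentValue q k = q * qNum (q : ℂ) k := by
  simp [contentValue, qInt_natCast hq, qNum_ofReal]

lemma mul_contentValue_add_ne_zero {q : ℝ} (hq : 0 < q) (c : ℤ) :
    ((q : ℂ) - 1) * contentValue q c + q ≠ 0 := by
  have h : ((q : ℂ) - 1) * contentValue q c + q = ((q * q ^ c : ℝ) : ℂ) := by
    rw [← one_add_mul_qInt, contentValue]
    push_cast
    ring
  rw [h]
  exact_mod_cast (mul_pos hq (zpow_pos hq c)).ne'

end QuantumIntegers

/-! ### A positive definite form making the generators symmetric. -/

section InvariantForm

variable {V : Type*} [AddCommGroup V] [Module ℂ V]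

/-- The pullback of a sesquilinear form along a linear map. -/
noncomputable def pullbackForm (f : V →ₗ⋆[ℂ] V →ₗ[ℂ] ℂ) (x : Module.End ℂ V) :
    V →ₗ⋆[ℂ] V →ₗ[ℂ] ℂ :=
  LinearMap.mk₂'ₛₗ (starRingEnd ℂ) (RingHom.id ℂ) (fun v w => f (x v) (x w))
    (by simp) (by simp) (by simp) (by simp)

/-- A Hecke system of operators on a finite-dimensional space is symmetric with respect to some
positive definite sesquilinear form. -/
lemma HeckeSystem.exists_form [FiniteDimensional ℂ V] {q : ℝ} (hq : 0 < q) {N : ℕ}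
    {T : ℕ → Module.End ℂ V} (H : HeckeSystem (q : ℂ) N T) :
    ∃ f : V →ₗ⋆[ℂ] V →ₗ[ℂ] ℂ, (∀ v, v ≠ 0 → 0 < (f v v).re) ∧
      ∀ i < N, ∀ v w, f (T i v) w = f v (T i w) := by
  suffices ∀ m ≤ N, ∃ f : V →ₗ⋆[ℂ] V →ₗ[ℂ] ℂ, (∀ v, v ≠ 0 → 0 < (f v v).re) ∧
      ∀ i < m, ∀ v w, f (T i v) w = f v (T i w) from this N le_rfl
  intro m
  induction m with
  | zero =>
    intro _
    let e : V ≃ₗ[ℂ] EuclideanSpace ℂ (Fin (Module.finrank ℂ V)) :=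
      LinearEquiv.ofFinrankEq _ _ (by simp)
    refine ⟨LinearMap.mk₂'ₛₗ (starRingEnd ℂ) (RingHom.id ℂ) (fun v w => inner ℂ (e v) (e w))
      (by simp) (by simp [mul_comm]) (by simp) (by simp), fun v hv => ?_, by simp⟩
    have : e v ≠ 0 := by simpa using hv
    change 0 < RCLike.re (inner ℂ (e v) (e v))
    rw [inner_self_eq_norm_sq]
    exact pow_pos (norm_pos_iff.2 this) 2
  | succ m ih =>
    intro hm
    obtain ⟨f, hpos, hf⟩ := ih (by omega)
    -- The analogue of averaging over a group, one coset step at a time. The weight `q^(-k)` makes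
    -- the two mixed terms symmetric in `v` and `w`, and `q > 0` keeps the form positive.
    let F : V →ₗ⋆[ℂ] V →ₗ[ℂ] ℂ := ∑ k ∈ Finset.range (m + 2),
      (((q ^ k)⁻¹ : ℝ) : ℂ) • pullbackForm f (desc T m k)
    have hF : ∀ v w, F v w = ∑ k ∈ Finset.range (m + 2),
        (((q ^ k)⁻¹ : ℝ) : ℂ) * f (desc T m k v) (desc T m k w) := fun v w => by
      simp [F, LinearMap.sum_apply, pullbackForm]
    have hnn : ∀ v, 0 ≤ (f v v).re := fun v => by
      by_cases hv : v = 0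
      · simp [hv]
      · exact (hpos v hv).le
    refine ⟨F, fun v hv => ?_, fun i hi v w => ?_⟩
    · rw [hF, Complex.re_sum]
      refine Finset.sum_pos' (fun k _ => ?_) ⟨0, by simp, ?_⟩
      · rw [Complex.re_ofReal_mul]
        exact mul_nonneg (inv_nonneg.2 (pow_nonneg hq.le k)) (hnn _)
      · simpa [desc] using hpos v hv
    · rw [hF, hF]
      refine Finset.sum_range_eq_of_pair (k := m - i) (by omega) (fun k hk h1 h2 => ?_) ?_
      · congr 1
        simp only [← Module.End.mul_apply]
        rcases Nat.lt_or_ge (i + k) m with hlt | hge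
        · rw [← (H.commute_desc (m := m) (by omega) hlt).eq]
          exact hf i (by omega) _ _
        · obtain ⟨i, rfl⟩ : ∃ i', i = i' + 1 := ⟨i - 1, by omega⟩
          rw [H.desc_mul_gen (m := m) (by omega) (by omega) (by omega) (by omega)]
          exact hf i (by omega) _ _
      · have e1 : desc T m (m - i) * T i = desc T m (m - i + 1) := by
          rw [desc, show m - (m - i) = i by omega]
        have e2 := H.desc_succ_mul_gen (m := m) (k := m - i) (by omega)
        rw [show m - (m - i) = i by omega] at e2
        simp only [← Module.End.mul_apply]
        rw [e1, e2]
        have hq' : (q : ℂ) ≠ 0 := by exact_mod_cast hq.ne'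
        simp only [LinearMap.add_apply, LinearMap.smul_apply, map_add, LinearMap.map_smulₛₗ,
          map_sub, map_one, Complex.conj_ofReal, smul_eq_mul, RingHom.id_apply]
        push_cast
        rw [pow_succ]
        field_simp
        ring

lemma HeckeSystem.jm_symmetric {q : ℝ} {N : ℕ} {T : ℕ → Module.End ℂ V}
    (H : HeckeSystem (q : ℂ) N T) {f : V →ₗ⋆[ℂ] V →ₗ[ℂ] ℂ}
    (hf : ∀ i < N, ∀ v w, f (T i v) w = f v (T i w)) {m : ℕ} (hm : m ≤ N) :
    ∀ v w, f (jm (q : ℂ) T m v) w = f v (jm (q : ℂ) T m w) := by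
  induction m with
  | zero => simp [jm]
  | succ m ih =>
    intro v w
    rw [H.jm_succ (by omega)]
    simp only [LinearMap.add_apply, LinearMap.smul_apply, map_add, LinearMap.map_smulₛₗ,
      Module.End.mul_apply, hf m (by omega), ih (by omega), map_inv₀, Complex.conj_ofReal,
      RingHom.id_apply]

end InvariantForm

/-! ### Joint spectrum of the Jucys-Murphy operators. -/

section Weights

variable {V : Type*} [AddCommGroup V] [Module ℂ V]

namespace HeckeSystem

variable {Q : ℂ} {N : ℕ} {T : ℕ → Module.End ℂ V}

/-- The intertwiner of two neighbouring weights exchanges them. -/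
lemma jm_intertwine (H : HeckeSystem Q N T) (hQ : Q ≠ 0) {i : ℕ} (hi : i < N) {v : V} {a b c : ℂ}
    (ha : jm Q T i v = a • v) (hb : jm Q T (i + 1) v = b • v) (hc : c * (b - a) = (Q - 1) * b + Q) :
    jm Q T i (T i v - c • v) = b • (T i v - c • v) ∧
      jm Q T (i + 1) (T i v - c • v) = a • (T i v - c • v) := by
  have h1 := LinearMap.congr_fun (H.gen_mul_jm_succ hQ hi) v
  have h2 := LinearMap.congr_fun (H.jm_succ_mul_gen hQ hi) v
  simp only [Module.End.mul_apply, LinearMap.add_apply, LinearMap.smul_apply, ha, hb, map_smul,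
    Module.End.one_apply] at h1 h2
  rw [map_sub, map_sub, map_smul, map_smul, ha, hb]
  constructor
  · linear_combination (norm := module) -h1 + hc • v
  · linear_combination (norm := module) h2 - hc • v

lemma content_of_gen_eigen (H : HeckeSystem Q N T) (hQ : Q ≠ 0) {i : ℕ} (hi : i < N) {v : V}
    (hv : v ≠ 0) {a b c : ℂ} (ha : jm Q T i v = a • v) (hb : jm Q T (i + 1) v = b • v)
    (hc : T i v = c • v) : c = Q ∧ b = Q * (a + 1) ∨ c = -1 ∧ a = Q * (b + 1) := by
  have h1 := LinearMap.congr_fun (H.quad i hi) v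
  have h2 := LinearMap.congr_fun (H.jm_succ (Q := Q) hi) v
  simp only [Module.End.mul_apply, LinearMap.add_apply, LinearMap.smul_apply, ha, hb, hc, map_smul,
    Module.End.one_apply, smul_smul, ← add_smul] at h1 h2
  have h1 := smul_left_injective ℂ hv h1
  have h2 := smul_left_injective ℂ hv h2
  have h3 : (c - Q) * (c + 1) = 0 := by linear_combination h1
  rcases mul_eq_zero.1 h3 with h | h
  · left
    obtain rfl : c = Q := sub_eq_zero.1 h
    refine ⟨rfl, ?_⟩
    rw [h2]
    field_simp
  · right
    obtain rfl : c = -1 := eq_neg_of_add_eq_zero_left h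
    refine ⟨rfl, ?_⟩
    rw [h2]
    field_simp
    ring

end HeckeSystem

/-- The vectors on which the operators `L k, L (k + 1), …` act by the contents in `s`. -/
noncomputable def weightSpace (q : ℝ) (L : ℕ → Module.End ℂ V) : ℕ → List ℤ → Submodule ℂ V
  | _, [] => ⊤
  | k, a :: s => LinearMap.ker (L k - contentValue q a • 1) ⊓ weightSpace q L (k + 1) s

variable {q : ℝ} {L : ℕ → Module.End ℂ V}

lemma mem_weightSpace_cons {k : ℕ} {a : ℤ} {s : List ℤ} {v : V} :
    v ∈ weightSpace q L k (a :: s) ↔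
      L k v = contentValue q a • v ∧ v ∈ weightSpace q L (k + 1) s := by
  simp [weightSpace, sub_eq_zero]

lemma mem_weightSpace_append {s t : List ℤ} {v : V} : ∀ {k : ℕ},
    v ∈ weightSpace q L k (s ++ t) ↔
      v ∈ weightSpace q L k s ∧ v ∈ weightSpace q L (k + s.length) t := by
  induction s with
  | nil => simp [weightSpace]
  | cons a s ih =>
    intro k
    rw [List.cons_append, mem_weightSpace_cons, mem_weightSpace_cons, ih, and_assoc,
      List.length_cons, add_right_comm, add_assoc]

lemma apply_mem_weightSpace {x : Module.End ℂ V} {s : List ℤ} {v : V} : ∀ {k : ℕ},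
    (∀ j, k ≤ j → j < k + s.length → Commute x (L j)) → v ∈ weightSpace q L k s →
      x v ∈ weightSpace q L k s := by
  induction s with
  | nil => simp [weightSpace]
  | cons a s ih =>
    intro k hx hv
    rw [mem_weightSpace_cons] at hv ⊢
    refine ⟨?_, ih (fun j h1 h2 => hx j (by omega) (by simp; omega)) hv.2⟩
    have := LinearMap.congr_fun (hx k le_rfl (by simp)).eq v
    rw [Module.End.mul_apply, Module.End.mul_apply, hv.1, map_smul] at this
    exact this.symm

lemma apply_of_mem_weightSpace {s : List ℤ} {v : V} : ∀ {k : ℕ}, v ∈ weightSpace q L k s →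
    ∀ (i : ℕ) (c : ℤ), s[i]? = some c → L (k + i) v = contentValue q c • v := by
  induction s with
  | nil => simp
  | cons a s ih =>
    intro k hv i c hi
    rw [mem_weightSpace_cons] at hv
    rcases i with _ | i
    · obtain rfl : a = c := by simpa using hi
      exact hv.1
    · rw [← ih hv.2 i c (by simpa using hi), add_assoc, add_comm 1 i]

namespace HeckeSystem

variable {N : ℕ} {T : ℕ → Module.End ℂ V}

lemma intertwine_mem_weightSpace (H : HeckeSystem (q : ℂ) N T) {s : List ℤ} (hs : s.length < N)
    {v : V} (hv : v ∈ weightSpace q (jm (q : ℂ) T) 0 s) (c : ℂ) :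
    T s.length v - c • v ∈ weightSpace q (jm (q : ℂ) T) 0 s := by
  refine Submodule.sub_mem _ ?_ (Submodule.smul_mem _ _ hv)
  exact apply_mem_weightSpace (fun j _ h => H.commute_jm_of_lt hs (by omega)) hv

/-- If `β` differs from the last eigenvalue, the intertwiner moves it one place earlier, or vanishes
and makes `β` adjacent to that eigenvalue. At the front the operator is `0`. -/
lemma exists_content_of_eigen (hq : 0 < q) (H : HeckeSystem (q : ℂ) N T) {β : ℂ} (s : List ℤ) :
    ∀ v : V, v ≠ 0 → s.length ≤ N → v ∈ weightSpace q (jm (q : ℂ) T) 0 s →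
      jm (q : ℂ) T s.length v = β • v → ∃ b, β = contentValue q b := by
  have hQ : (q : ℂ) ≠ 0 := by exact_mod_cast hq.ne'
  induction s using List.reverseRecOn with
  | nil =>
    intro v hv _ _ h
    refine ⟨0, ?_⟩
    rw [contentValue_zero]
    simpa [jm, hv, eq_comm] using h
  | append_singleton s a ih =>
    intro v hv hs hmem h
    rw [mem_weightSpace_append, mem_weightSpace_cons, zero_add] at hmem
    rw [List.length_append, List.length_singleton] at hs h
    by_cases hβ : β = contentValue q a
    · exact ⟨a, hβ⟩
    set c := (((q : ℂ) - 1) * β + q) / (β - contentValue q a) with hc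
    have hc' : c * (β - contentValue q a) = ((q : ℂ) - 1) * β + q :=
      div_mul_cancel₀ _ (sub_ne_zero.2 hβ)
    by_cases hw : T s.length v - c • v = 0
    · rcases H.content_of_gen_eigen hQ (by omega) hv hmem.2.1 h (sub_eq_zero.1 hw) with
        ⟨_, h⟩ | ⟨_, h⟩
      · exact ⟨a + 1, by rw [contentValue_add_one hq, h]⟩
      · refine ⟨a - 1, ?_⟩
        have := contentValue_add_one hq (a - 1)
        rw [sub_add_cancel, h] at this
        exact add_right_cancel (mul_left_cancel₀ hQ this)
    · exact ih _ hw (by omega) (H.intertwine_mem_weightSpace (by omega) hmem.1 c)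
        (H.jm_intertwine hQ (by omega) hmem.2.1 h hc').1

/-- Contents that differ by one are fixed by the generator that would exchange them. -/
lemma gen_eigen_of_adjacent (hq : 0 < q) (H : HeckeSystem (q : ℂ) N T)
    {f : V →ₗ⋆[ℂ] V →ₗ[ℂ] ℂ} (hpos : ∀ v, v ≠ 0 → 0 < (f v v).re)
    (hf : ∀ i < N, ∀ v w, f (T i v) w = f v (T i w)) {i : ℕ} (hi : i < N) {v : V} {a b : ℤ}
    (hab : |a - b| = 1) (ha : jm (q : ℂ) T i v = contentValue q a • v)
    (hb : jm (q : ℂ) T (i + 1) v = contentValue q b • v) : ∃ c : ℂ, T i v = c • v := by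
  have hQ : (q : ℂ) ≠ 0 := by exact_mod_cast hq.ne'
  obtain ⟨c, c', hc, hc'⟩ : ∃ c c' : ℂ, c * (contentValue q b - contentValue q a) =
      ((q : ℂ) - 1) * contentValue q b + q ∧ ((q : ℂ) - 1 - c = c' ∧ (q : ℂ) = -c' * c) := by
    rcases (abs_eq zero_le_one).1 hab with h | h
    · obtain rfl : a = b + 1 := by omega
      refine ⟨-1, q, ?_, by ring, by ring⟩
      rw [contentValue_add_one hq]
      ring
    · obtain rfl : b = a + 1 := by omega
      refine ⟨q, -1, ?_, by ring, by ring⟩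
      rw [contentValue_add_one hq]
      ring
  refine ⟨c, sub_eq_zero.1 ?_⟩
  obtain ⟨h1, _⟩ := H.jm_intertwine hQ hi ha hb hc
  set w := T i v - c • v with hw
  by_contra hne
  -- `c` and `c'` are the two roots of the quadratic relation, so `w` is an eigenvector for the
  -- other root. It is orthogonal to `v`, and symmetry of `T i` then gives `f w w = 0`.
  have hTw : T i w = c' • w := by
    have h := LinearMap.congr_fun (H.quad i hi) v
    simp only [Module.End.mul_apply, LinearMap.add_apply, LinearMap.smul_apply,
      Module.End.one_apply] at h
    rw [hw, map_sub, map_smul, h, ← hc'.1]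
    nth_rewrite 2 [hc'.2]
    rw [← hc'.1]
    module
  have hvw : f v w = 0 := by
    have h := H.jm_symmetric hf hi.le v w
    rw [ha, h1, LinearMap.map_smulₛₗ, conj_contentValue, LinearMap.smul_apply, map_smul,
      smul_eq_mul, smul_eq_mul] at h
    have h' : (contentValue q a - contentValue q b) * f v w = 0 := by linear_combination h
    refine (mul_eq_zero.1 h').resolve_left fun h0 => ?_
    have := contentValue_injective hq (sub_eq_zero.1 h0)
    simp [this] at hab
  have h := hf i hi v w
  rw [hTw, map_smul, hvw, show T i v = w + c • v by rw [hw]; abel, map_add, LinearMap.add_apply,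
    LinearMap.map_smulₛₗ, LinearMap.smul_apply, hvw, smul_zero, smul_zero, add_zero] at h
  have := hpos w hne
  rw [h] at this
  simp at this

/-- Pairing `v` with `jm i (T i v)` in two ways gives `((q - 1) α + q) f v v = 0` for the repeated
eigenvalue `α`. The scalar equals `q * q ^ a`, which is nonzero. -/
lemma not_repeat (hq : 0 < q) (H : HeckeSystem (q : ℂ) N T)
    {f : V →ₗ⋆[ℂ] V →ₗ[ℂ] ℂ} (hpos : ∀ v, v ≠ 0 → 0 < (f v v).re)
    (hf : ∀ i < N, ∀ v w, f (T i v) w = f v (T i w)) {i : ℕ} (hi : i < N) {v : V} (hv : v ≠ 0)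
    {a : ℤ} (ha : jm (q : ℂ) T i v = contentValue q a • v)
    (hb : jm (q : ℂ) T (i + 1) v = contentValue q a • v) : False := by
  have hQ : (q : ℂ) ≠ 0 := by exact_mod_cast hq.ne'
  have h1 := LinearMap.congr_fun (H.gen_mul_jm_succ hQ hi) v
  simp only [Module.End.mul_apply, LinearMap.add_apply, LinearMap.smul_apply, hb, map_smul,
    Module.End.one_apply] at h1
  have h2 := H.jm_symmetric hf hi.le v (T i v)
  have h3 : jm (q : ℂ) T i (T i v) = contentValue q a • T i v -
      (((q : ℂ) - 1) * contentValue q a + q) • v := by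
    linear_combination (norm := module) -h1
  rw [ha, h3, LinearMap.map_smulₛₗ, conj_contentValue, LinearMap.smul_apply, map_sub, map_smul,
    map_smul, eq_comm, sub_eq_self, smul_eq_mul] at h2
  have := hpos v hv
  rw [(mul_eq_zero.1 h2).resolve_left (mul_contentValue_add_ne_zero hq a)] at this
  simp at this

/-- The lists of contents of joint eigenvectors of the Jucys-Murphy elements. -/
lemma weightSystem [FiniteDimensional ℂ V] (hq : 0 < q) (H : HeckeSystem (q : ℂ) N T) :
    WeightSystem (N + 1) fun s => s.length ≤ N + 1 ∧
      ∃ v, v ≠ 0 ∧ v ∈ weightSpace q (jm (q : ℂ) T) 0 s := by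
  have hQ : (q : ℂ) ≠ 0 := by exact_mod_cast hq.ne'
  obtain ⟨f, hpos, hf⟩ := H.exists_form hq
  have inj := contentValue_injective hq
  constructor
  · rintro s t ⟨hl, v, hv, hmem⟩
    rw [List.length_append] at hl
    exact ⟨by omega, v, hv, (mem_weightSpace_append.1 hmem).1⟩
  · rintro s ⟨_, v, hv, hmem⟩ hl
    set W := weightSpace q (jm (q : ℂ) T) 0 s
    have hinv : ∀ w ∈ W, jm (q : ℂ) T s.length w ∈ W := fun w hw =>
      apply_mem_weightSpace (fun j _ h => H.commute_jm_jm hQ (by omega) (by omega)) hw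
    have : Nontrivial W := ⟨⟨v, hmem⟩, 0, fun h => hv (congrArg Subtype.val h)⟩
    obtain ⟨β, hβ⟩ := Module.End.exists_eigenvalue ((jm (q : ℂ) T s.length).restrict hinv)
    obtain ⟨w, hw⟩ := hβ.exists_hasEigenvector
    have hw0 : (w : V) ≠ 0 := fun h => hw.2 (Subtype.ext h)
    have hwe : jm (q : ℂ) T s.length (w : V) = β • (w : V) :=
      congrArg Subtype.val hw.apply_eq_smul
    obtain ⟨b, rfl⟩ := H.exists_content_of_eigen hq s w hw0 (by omega) w.2 hwe
    refine ⟨b, by simp; omega, w, hw0, mem_weightSpace_append.2 ⟨w.2, ?_⟩⟩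
    rw [mem_weightSpace_cons, zero_add]
    exact ⟨hwe, Submodule.mem_top⟩
  · rintro b ⟨_, v, hv, hmem⟩
    rw [mem_weightSpace_cons] at hmem
    refine inj ?_
    rw [contentValue_zero]
    simpa [jm, hv, eq_comm] using hmem.1
  · rintro s t a b hab ⟨hl, v, hv, hmem⟩
    rw [mem_weightSpace_append, mem_weightSpace_cons, mem_weightSpace_cons, zero_add] at hmem
    obtain ⟨hs, ha, hb, ht⟩ := hmem
    simp only [List.length_append, List.length_cons] at hl
    have hne : contentValue q b - contentValue q a ≠ 0 := fun h => by
      have := inj (sub_eq_zero.1 h)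
      simp [this] at hab
    set c := (((q : ℂ) - 1) * contentValue q b + q) / (contentValue q b - contentValue q a)
    have hc : c * (contentValue q b - contentValue q a) =
      ((q : ℂ) - 1) * contentValue q b + q := div_mul_cancel₀ _ hne
    obtain ⟨h1, h2⟩ := H.jm_intertwine hQ (by omega) ha hb hc
    -- The intertwined vector vanishes only if the contents differ by one.
    refine ⟨by simp; omega, T s.length v - c • v, fun h0 => ?_, ?_⟩
    · rcases H.content_of_gen_eigen hQ (by omega) hv ha hb (sub_eq_zero.1 h0) with ⟨_, h⟩ | ⟨_, h⟩
      · rw [← contentValue_add_one hq] at h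
        simp [inj h] at hab
      · rw [← contentValue_add_one hq] at h
        simp [inj h] at hab
    · rw [mem_weightSpace_append, mem_weightSpace_cons, mem_weightSpace_cons, zero_add]
      refine ⟨H.intertwine_mem_weightSpace (by omega) hs c, h1, h2, ?_⟩
      refine Submodule.sub_mem _ ?_ (Submodule.smul_mem _ _ ht)
      exact apply_mem_weightSpace
        (fun j h1 h2 => H.commute_jm_of_add_two_le hQ (by omega) (by omega)) ht
  · rintro s a ⟨hl, v, hv, hmem⟩
    rw [mem_weightSpace_append, mem_weightSpace_cons, mem_weightSpace_cons, zero_add] at hmem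
    simp only [List.length_append, List.length_cons, List.length_nil] at hl
    exact H.not_repeat hq hpos hf (by omega) hv hmem.2.1 hmem.2.2.1
  · rintro s a b hab ⟨hl, v, hv, hmem⟩
    rw [mem_weightSpace_append, mem_weightSpace_cons, mem_weightSpace_cons, mem_weightSpace_cons,
      zero_add] at hmem
    simp only [List.length_append, List.length_cons, List.length_nil] at hl
    obtain ⟨_, h1, h2, h3, _⟩ := hmem
    obtain ⟨c, hc⟩ := H.gen_eigen_of_adjacent hq hpos hf (by omega) hab h1 h2
    obtain ⟨d, hd⟩ := H.gen_eigen_of_adjacent hq hpos hf (by omega) (by rwa [abs_sub_comm]) h2 h3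
    have hbr := LinearMap.congr_fun (H.braid s.length (by omega)) v
    simp only [Module.End.mul_apply, hc, hd, map_smul, smul_smul] at hbr
    have hbr := smul_left_injective ℂ hv hbr
    have hcd := H.content_of_gen_eigen hQ (by omega) hv h1 h2 hc
    have hdd := H.content_of_gen_eigen hQ (by omega) hv h2 h3 hd
    simp only [← contentValue_add_one hq] at hcd hdd
    -- Equal eigenvalues would make the content rise twice or fall twice, but it returns to `a`.
    -- Different ones violate the braid relation unless `q (q + 1) = 0`.
    rcases hcd with ⟨rfl, e⟩ | ⟨rfl, e⟩ <;> rcases hdd with ⟨rfl, e'⟩ | ⟨rfl, e'⟩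
    · have := inj e
      have := inj e'
      omega
    · have : (q : ℂ) * (q + 1) = 0 := by linear_combination -hbr
      have : q * (q + 1) = 0 := by exact_mod_cast this
      nlinarith
    · have : (q : ℂ) * (q + 1) = 0 := by linear_combination hbr
      have : q * (q + 1) = 0 := by exact_mod_cast this
      nlinarith
    · have := inj e
      have := inj e'
      omega

end HeckeSystem

end Weights

/-! ### Finite dimension and central elements. -/

section FiniteDimensional

variable {K A : Type*} [Field K] [Ring A] [Algebra K A] {Q : K} {N : ℕ} {h : ℕ → A}

/-- The words in the generators of a Hecke system span a finite-dimensional space. -/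
lemma HeckeSystem.exists_fg (H : HeckeSystem Q N h) : ∀ m ≤ N, ∃ S : Submodule K A,
    S.FG ∧ 1 ∈ S ∧ ∀ i < m, ∀ x ∈ S, x * h i ∈ S := by
  intro m
  induction m with
  | zero => exact fun _ => ⟨K ∙ 1, Submodule.fg_span_singleton 1,
      Submodule.mem_span_singleton_self 1, by simp⟩
  | succ m ih =>
    intro hm
    obtain ⟨S, hfg, h1, hS⟩ := ih (by omega)
    let S' : Submodule K A :=
      ⨆ k ∈ Finset.range (m + 2), S.map (LinearMap.mulRight K (desc h m k))
    have hmem : ∀ k < m + 2, ∀ x ∈ S, x * desc h m k ∈ S' := fun k hk x hx =>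
      Submodule.mem_iSup_of_mem k
        (Submodule.mem_iSup_of_mem (Finset.mem_range.2 hk) ⟨x, hx, rfl⟩)
    refine ⟨S', Submodule.fg_biSup _ _ fun k _ => hfg.map _, ?_, fun i hi => ?_⟩
    · simpa [desc] using hmem 0 (by omega) 1 h1
    · suffices S' ≤ S'.comap (LinearMap.mulRight K (h i)) from fun x hx => this hx
      refine iSup₂_le fun k hk => ?_
      rw [Finset.mem_range] at hk
      rintro _ ⟨x, hx, rfl⟩
      change x * desc h m k * h i ∈ S'
      rw [mul_assoc]
      rcases lt_trichotomy (i + k) m with hlt | heq | hgt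
      · rw [← (H.commute_desc (m := m) (by omega) hlt).eq, ← mul_assoc]
        exact hmem k hk _ (hS i (by omega) x hx)
      · have e := desc.eq_2 h m k
        rw [show m - k = i by omega] at e
        rw [← e]
        exact hmem (k + 1) (by omega) x hx
      · rcases Nat.eq_or_lt_of_le (Nat.succ_le_of_lt hgt) with heq | hgt
        · obtain ⟨k, rfl⟩ : ∃ k', k = k' + 1 := ⟨k - 1, by omega⟩
          have e := H.desc_succ_mul_gen (m := m) (k := k) (by omega)
          rw [show m - k = i by omega] at e
          rw [e, mul_add, mul_smul_comm, mul_smul_comm]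
          exact S'.add_mem (S'.smul_mem _ (hmem _ hk x hx))
            (S'.smul_mem _ (hmem k (by omega) x hx))
        · obtain ⟨i, rfl⟩ : ∃ i', i = i' + 1 := ⟨i - 1, by omega⟩
          rw [H.desc_mul_gen (m := m) (by omega) (by omega) (by omega) (by omega), ← mul_assoc]
          exact hmem k hk _ (hS i (by omega) x hx)

/-- The characteristic element `∏ (x - jm p)` of the Jucys-Murphy elements. -/
def jmChar (Q : K) (h : ℕ → A) (x : K) : ℕ → A
  | 0 => 1
  | m + 1 => jmChar Q h x m * (algebraMap K A x - jm Q h m)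

/-- The generator commutes with every factor except those of `jm i` and `jm (i + 1)`, and with the
sum and product of these two. Only a cut exactly between them, `m = i + 1`, is excluded. -/
lemma HeckeSystem.commute_jmChar (H : HeckeSystem Q N h) (hQ : Q ≠ 0) (x : K) {i m : ℕ}
    (hi : i < N) (hm : m ≤ N + 1) (him : i + 2 ≤ m ∨ m ≤ i) : Commute (h i) (jmChar Q h x m) := by
  induction m using Nat.strong_induction_on with
  | _ m ih =>
    have c0 : Commute (h i) (algebraMap K A x) := (Algebra.commutes x (h i)).symm
    rcases m with _ | m
    · exact Commute.one_right _
    rcases Nat.lt_or_ge m i with hlt | hge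
    · exact (ih m (by omega) (by omega) (by omega)).mul_right
        (c0.sub_right (H.commute_jm_of_lt hi hlt))
    rcases Nat.lt_or_ge (i + 1) m with hlt | hge'
    · exact (ih m (by omega) (by omega) (by omega)).mul_right
        (c0.sub_right (H.commute_jm_of_add_two_le hQ (by omega) (by omega)))
    obtain rfl : m = i + 1 := by omega
    rw [jmChar, jmChar, mul_assoc]
    refine (ih i (by omega) (by omega) (by omega)).mul_right ?_
    have h1 := H.gen_mul_jm_succ hQ hi
    have h2 := H.jm_succ_mul_gen hQ hi
    have h3 := (H.commute_jm_jm hQ (i := i) (m := i + 1) (by omega) (by omega)).eq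
    set a := jm Q h i
    set b := jm Q h (i + 1)
    have hs : Commute (h i) (a + b) := by
      rw [Commute, SemiconjBy, mul_add, add_mul, h1, h2]
      abel
    have hp : Commute (h i) (a * b) := by
      rw [Commute, SemiconjBy]
      calc h i * (a * b) = (h i * b) * a := by rw [h3, mul_assoc]
        _ = a * (h i * a) + (Q - 1) • (b * a) + Q • a := by
          rw [h1]; simp only [add_mul, smul_mul_assoc, one_mul, mul_assoc]
        _ = a * (b * h i) := by
          rw [h2, ← h3]; simp only [mul_add, mul_smul_comm, mul_one]
        _ = _ := (mul_assoc _ _ _).symm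
    have e : (algebraMap K A x - a) * (algebraMap K A x - b) =
        algebraMap K A x * algebraMap K A x - algebraMap K A x * (a + b) + a * b := by
      rw [sub_mul, mul_sub, mul_sub, mul_add, ← Algebra.commutes x a]
      abel
    rw [e]
    exact ((c0.mul_right c0).sub_right (c0.mul_right hs)).add_right hp

variable {M : Type*} [AddCommGroup M] [Module A M] [Module K M] [IsScalarTower K A M]

lemma HeckeSystem.jmChar_smul_eq_zero (H : HeckeSystem Q N h) (hQ : Q ≠ 0) {x : K} {m p : ℕ}
    (hm : m ≤ N + 1) (hp : p < m) {w : M} (hw : jm Q h p • w = x • w) :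
    jmChar Q h x m • w = 0 := by
  induction m with
  | zero => omega
  | succ m ih =>
    rcases Nat.eq_or_lt_of_le (Nat.le_of_lt_succ hp) with rfl | hlt
    · rw [jmChar, mul_smul, sub_smul, algebraMap_smul, hw, sub_self, smul_zero]
    · have c : ∀ k ≤ N, ∀ j ≤ N + 1, Commute (jm Q h k) (jmChar Q h x j) := by
        intro k hk j hj
        induction j with
        | zero => exact Commute.one_right _
        | succ j ihj =>
          exact (ihj (by omega)).mul_right ((Algebra.commute_algebraMap_right x _).sub_right
            (H.commute_jm_jm hQ hk (by omega)))
      have c' : Commute (jmChar Q h x m) (algebraMap K A x - jm Q h m) :=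
        Commute.sub_right (Algebra.commute_algebraMap_right x _) (c m (by omega) m (by omega)).symm
      rw [jmChar, c'.eq, mul_smul, ih (by omega) hlt, smul_zero]

lemma jmChar_smul {x : K} {m : ℕ} {a : ℕ → K} {v : M} (hv : ∀ p < m, jm Q h p • v = a p • v) :
    jmChar Q h x m • v = (∏ p ∈ Finset.range m, (x - a p)) • v := by
  induction m with
  | zero => simp [jmChar]
  | succ m ih =>
    rw [jmChar, mul_smul, sub_smul, algebraMap_smul, hv m (by omega), ← sub_smul, smul_comm,
      ih fun p hp => hv p (by omega), smul_smul, Finset.prod_range_succ, mul_comm]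

end FiniteDimensional

/-! ### The Hecke algebra, its projectors and its simple modules. -/

section HeckeAlgebra

variable {n : ℕ} {q : ℝ}

/-- An induction principle for the Hecke algebra. -/
lemma Hecke.induction {P : Hecke n q → Prop} (hc : ∀ c : ℂ, P (algebraMap ℂ _ c))
    (hg : ∀ t < n - 1, P (heckeGen n q (t + 1))) (hmul : ∀ x y, P x → P y → P (x * y))
    (hadd : ∀ x y, P x → P y → P (x + y)) (x : Hecke n q) : P x := by
  obtain ⟨x, rfl⟩ := RingQuot.mkAlgHom_surjective ℂ (HeckeRel n q) x
  induction x using FreeAlgebra.induction with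
  | grade0 r => rw [AlgHom.commutes]; exact hc r
  | grade1 i =>
    have := hg (i.1 - 1) (by have := i.2; omega)
    rw [Nat.sub_add_cancel i.2.1, heckeGen, dif_pos i.2] at this
    exact this
  | mul a b ha hb => rw [map_mul]; exact hmul _ _ ha hb
  | add a b ha hb => rw [map_add]; exact hadd _ _ ha hb

lemma heckeSystem_heckeGen (n : ℕ) (q : ℝ) :
    HeckeSystem (q : ℂ) (n - 1) fun t => heckeGen n q (t + 1) where
  quad i hi := by
    have hi' : 1 ≤ i + 1 ∧ i + 1 < n := by omega
    have := RingQuot.mkAlgHom_rel ℂ (HeckeRel.quad (n := n) (q := q) ⟨i + 1, hi'⟩)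
    simp only [heckeGen, dif_pos hi']
    rw [map_mul, map_add, map_smul, AlgHom.commutes, Algebra.algebraMap_eq_smul_one,
      Complex.ofReal_sub, Complex.ofReal_one] at this
    exact this
  braid i hi := by
    have hi' : 1 ≤ i + 1 ∧ i + 1 < n := by omega
    have hj' : 1 ≤ i + 1 + 1 ∧ i + 1 + 1 < n := by omega
    have := RingQuot.mkAlgHom_rel ℂ
      (HeckeRel.braid (n := n) (q := q) ⟨i + 1, hi'⟩ ⟨i + 1 + 1, hj'⟩ rfl)
    simp only [heckeGen, dif_pos hi', dif_pos hj']
    simpa using this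
  comm i j hij hj := by
    have hi' : 1 ≤ i + 1 ∧ i + 1 < n := by omega
    have hj' : 1 ≤ j + 1 ∧ j + 1 < n := by omega
    have := RingQuot.mkAlgHom_rel ℂ
      (HeckeRel.comm (n := n) (q := q) ⟨i + 1, hi'⟩ ⟨j + 1, hj'⟩ (by simp; omega))
    simp only [heckeGen, dif_pos hi', dif_pos hj']
    simpa using this

lemma heckeSystem_shift {j N : ℕ} (hj : 1 ≤ j) (hN : N + j ≤ n) :
    HeckeSystem (q : ℂ) N fun t => heckeGen n q (t + j) := by
  have := (heckeSystem_heckeGen n q).shift (M := N) (c := j - 1) (by omega)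
  have e : ∀ t, t + (j - 1) + 1 = t + j := fun t => by omega
  simpa only [e] using this

instance : Module.Finite ℂ (Hecke n q) := by
  obtain ⟨S, hfg, h1, hS⟩ := (heckeSystem_heckeGen n q).exists_fg (n - 1) le_rfl
  have hmul : ∀ y : Hecke n q, ∀ x ∈ S, x * y ∈ S := by
    intro y
    induction y using Hecke.induction with
    | hc c =>
      intro x hx
      rw [← Algebra.commutes, ← Algebra.smul_def]
      exact S.smul_mem c hx
    | hg t ht => exact hS t ht
    | hmul y z hy hz =>
      intro x hx
      rw [← mul_assoc]
      exact hz _ (hy x hx)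
    | hadd y z hy hz =>
      intro x hx
      rw [mul_add]
      exact S.add_mem (hy x hx) (hz x hx)
  obtain rfl : S = ⊤ := eq_top_iff.2 fun y _ => by simpa using hmul y 1 h1
  exact ⟨hfg⟩

lemma heckePalin_eq (k : ℕ) : ∀ a, heckePalin n q a k = palin (heckeGen n q) a k := by
  induction k with
  | zero => intro a; rfl
  | succ k ih => intro a; rw [heckePalin, palin, ih]

lemma murphy_eq (j m : ℕ) :
    murphy n q j (m + 1) = jm (q : ℂ) (fun t => heckeGen n q (t + j)) m := by
  rw [jm_shift, murphy]
  refine Finset.sum_congr rfl fun k hk => ?_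
  rw [Finset.mem_range] at hk
  rw [heckePalin_eq, show m + 1 + j - 2 - k = m - 1 - k + j by omega]
  push_cast
  rfl

lemma rowProj_eq (hq : 0 < q) (j m : ℕ) :
    rowProj n q j (m + 1) = sym (q : ℂ) (fun t => heckeGen n q (t + j)) m := by
  induction m with
  | zero => simp [rowProj, sym]
  | succ m ih =>
    have e : rowProj n q j (m + 1 + 1) = rowProj n q j (m + 1) *
        ((((qInt q ((m + 2 : ℕ) : ℤ))⁻¹ : ℝ) : ℂ) • (murphy n q j (m + 2) + 1)) := by
      simp [rowProj, List.range_succ]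
    rw [e, ih, sym, murphy_eq, qInt_natCast hq, mul_smul_comm, qNum_ofReal, Complex.ofReal_inv]

lemma eProj_eq (hq : 0 < q) (i j : ℕ) : eProj n q i j =
    ((qSym q (i + 1) : ℝ) : ℂ) • sym (q : ℂ) (fun t => heckeGen n q (t + j)) i := by
  rw [eProj, rowProj_eq hq]

lemma qSym_succ (hq : 0 < q) (k : ℕ) :
    qSym q (k + 1) = (q ^ (-(1 / 2) : ℝ)) ^ k * qNum q (k + 1) := by
  rw [qSym, qInt_natCast hq, ← Real.rpow_natCast, ← Real.rpow_mul hq.le]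
  congr 2
  push_cast
  ring

lemma qSym_succ_ne_zero (hq : 0 < q) (k : ℕ) : qSym q (k + 1) ≠ 0 := by
  rw [qSym_succ hq]
  exact mul_ne_zero (pow_ne_zero _ (Real.rpow_pos_of_pos hq _).ne') (qNum_pos hq k).ne'

lemma ofReal_qSym_succ (hq : 0 < q) (k : ℕ) :
    ((qSym q (k + 1) : ℝ) : ℂ) = ((q ^ (-(1 / 2) : ℝ) : ℝ) : ℂ) ^ k * qNum (q : ℂ) (k + 1) := by
  rw [qSym_succ hq, qNum_ofReal]
  push_cast
  rfl

lemma rpow_neg_half_sq_mul (hq : 0 < q) :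
    ((q ^ (-(1 / 2) : ℝ) : ℝ) : ℂ) ^ 2 * (q : ℂ) = 1 := by
  have : (q ^ (-(1 / 2) : ℝ)) ^ 2 * q = 1 := by
    rw [← Real.rpow_natCast, ← Real.rpow_mul hq.le]
    norm_num
    rw [Real.rpow_neg_one, inv_mul_cancel₀ hq.ne']
  exact_mod_cast this

lemma eProj_sq (hq : 0 < q) {i j : ℕ} (hj : 1 ≤ j) (hn : j + i ≤ n) :
    eProj n q i j ^ 2 = ((qSym q (i + 1) : ℝ) : ℂ) • eProj n q i j := by
  have hQ : (q : ℂ) ≠ 0 := by exact_mod_cast hq.ne'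
  have H : HeckeSystem (q : ℂ) i fun t => heckeGen n q (t + j) :=
    heckeSystem_shift hj (by omega)
  rw [eProj_eq hq, pow_two, smul_mul_smul_comm, H.sym_mul_sym hQ (qNum_ne_zero hq) le_rfl,
    smul_smul]

lemma eProj_eq_scaled (hq : 0 < q) (m j : ℕ) : eProj n q (m + 1) j =
    (((q ^ (-(1 / 2) : ℝ) : ℝ) : ℂ) ^ (m + 1) * qNum (q : ℂ) (m + 2)) •
      sym (q : ℂ) (fun t => heckeGen n q (t + j)) (m + 1) := by
  rw [eProj_eq hq, ofReal_qSym_succ hq]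

lemma eProj_succ_eq_scaled (hq : 0 < q) (m j : ℕ) : eProj n q (m + 1) (j + 1) =
    (((q ^ (-(1 / 2) : ℝ) : ℝ) : ℂ) ^ (m + 1) * qNum (q : ℂ) (m + 2)) •
      sym (q : ℂ) (fun t => (fun t => heckeGen n q (t + j)) (t + 1)) (m + 1) := by
  have e : ∀ t, t + (j + 1) = t + 1 + j := fun t => by omega
  rw [eProj_eq_scaled hq]
  simp only [e]

lemma eProj_mul_mul_sub (hq : 0 < q) {i j : ℕ} (hi : 1 ≤ i) (hj : 1 ≤ j) (hn : j + i + 1 ≤ n) :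
    eProj n q i j * eProj n q i (j + 1) * eProj n q i j - eProj n q i j =
      ((qSym q i * qSym q (i + 1) : ℝ) : ℂ) • eProj n q (i + 1) j := by
  have hQ : (q : ℂ) ≠ 0 := by exact_mod_cast hq.ne'
  obtain ⟨m, rfl⟩ : ∃ m, i = m + 1 := ⟨i - 1, by omega⟩
  have H : HeckeSystem (q : ℂ) (m + 2) fun t => heckeGen n q (t + j) :=
    heckeSystem_shift hj (by omega)
  rw [H.smul_sym_succ_eq hQ (qNum_ne_zero hq) (rpow_neg_half_sq_mul hq) (by omega)
    (eProj_eq_scaled hq m j) (eProj_succ_eq_scaled hq m j), eProj_eq_scaled hq (m + 1) j,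
    Complex.ofReal_mul, ofReal_qSym_succ hq, ofReal_qSym_succ hq]

lemma eProj_braid_sub (hq : 0 < q) {i j : ℕ} (hi : 1 ≤ i) (hj : 1 ≤ j) (hn : j + i + 1 ≤ n) :
    eProj n q i j * eProj n q i (j + 1) * eProj n q i j - eProj n q i j =
      eProj n q i (j + 1) * eProj n q i j * eProj n q i (j + 1) - eProj n q i (j + 1) := by
  have hQ : (q : ℂ) ≠ 0 := by exact_mod_cast hq.ne'
  obtain ⟨m, rfl⟩ : ∃ m, i = m + 1 := ⟨i - 1, by omega⟩
  have H : HeckeSystem (q : ℂ) (m + 2) fun t => heckeGen n q (t + j) :=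
    heckeSystem_shift hj (by omega)
  exact H.braid_sub_eq hQ (qNum_ne_zero hq) (rpow_neg_half_sq_mul hq) (by omega)
    (eProj_eq_scaled hq m j) (eProj_succ_eq_scaled hq m j)

lemma mem_tlRelators_iff (hq : 0 < q) {l : ℕ} (hl : 2 ≤ l) {x : Hecke n q} :
    x ∈ tlRelators n q (l - 1) ↔ ∃ j, 1 ≤ j ∧ j + l ≤ n ∧
      x = ((qSym q (l - 1) * qSym q l : ℝ) : ℂ) • eProj n q l j := by
  obtain ⟨i, rfl⟩ : ∃ i, l = i + 1 := ⟨l - 1, by omega⟩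
  rw [Nat.add_sub_cancel]
  constructor
  · rintro ⟨j, k, hj, hjn, hk, hkn, rfl | rfl, rfl⟩
    · exact ⟨j, hj, by omega, eProj_mul_mul_sub hq (by omega) hj (by omega)⟩
    · refine ⟨k, hk, by omega, ?_⟩
      rw [← eProj_braid_sub hq (by omega) hk (by omega)]
      exact eProj_mul_mul_sub hq (by omega) hk (by omega)
  · rintro ⟨j, hj, hjn, rfl⟩
    exact ⟨j, j + 1, hj, by omega, by omega, by omega, Or.inl rfl,
      (eProj_mul_mul_sub hq (by omega) hj (by omega)).symm⟩

lemma qSym_mul_ne_zero (hq : 0 < q) {l : ℕ} (hl : 2 ≤ l) :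
    ((qSym q (l - 1) * qSym q l : ℝ) : ℂ) ≠ 0 := by
  obtain ⟨i, rfl⟩ : ∃ i, l = i + 2 := ⟨l - 2, by omega⟩
  exact_mod_cast mul_ne_zero (qSym_succ_ne_zero hq i) (qSym_succ_ne_zero hq (i + 1))

section Modules

variable {V : Type*} [AddCommGroup V] [Module (Hecke n q) V]

lemma smul_smul_eq_zero_iff (c : ℂ) (hc : c ≠ 0) (x : Hecke n q) (v : V) :
    (c • x) • v = 0 ↔ x • v = 0 := by
  constructor
  · intro h
    have : x • v = algebraMap ℂ (Hecke n q) c⁻¹ • (c • x) • v := by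
      rw [smul_smul, ← Algebra.smul_def, smul_smul, inv_mul_cancel₀ hc, one_smul]
    rw [this, h, smul_zero]
  · intro h
    rw [Algebra.smul_def, mul_smul, h, smul_zero]

lemma factorsThrough_span_iff (S : Set (Hecke n q)) :
    FactorsThrough n q (TwoSidedIdeal.span S) V ↔ ∀ x ∈ S, ∀ v : V, x • v = 0 := by
  have key : ∀ x, x ∈ TwoSidedIdeal.ker (Module.toAddMonoidEnd (Hecke n q) V) ↔
      ∀ v : V, x • v = 0 := fun x => by
    rw [TwoSidedIdeal.mem_ker, DFunLike.ext_iff]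
    rfl
  constructor
  · exact fun h x hx => h x (TwoSidedIdeal.subset_span hx)
  · intro h x hx
    refine (key x).1 (TwoSidedIdeal.span_le.2 (fun y hy => ?_) hx)
    exact (key y).2 (h y hy)

/-- If one single-row projector annihilates `V`, then so do all its translates. -/
lemma eProj_smul_eq_zero (hq : 0 < q) {l : ℕ} (hl : 1 ≤ l) (h : ∀ v : V, eProj n q l 1 • v = 0)
    {j : ℕ} (hj : 1 ≤ j) (hn : j + l ≤ n) (v : V) : eProj n q l j • v = 0 := by
  induction j, hj using Nat.le_induction generalizing v with
  | base => exact h v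
  | succ j hj ih =>
    have ih := ih (by omega)
    -- With `e_j` acting as zero, this identity reduces to `0 = -e_{j+1}`.
    have e := congrArg (· • v) (eProj_braid_sub (n := n) hq hl hj (by omega))
    simp only [sub_smul, mul_smul, ih, smul_zero, sub_zero, zero_sub] at e
    exact neg_eq_zero.1 e.symm

lemma factorsThrough_tl_iff (hq : 0 < q) {l : ℕ} (hl : 2 ≤ l) :
    FactorsThrough n q (TwoSidedIdeal.span (tlRelators n q (l - 1))) V ↔
      (l + 1 ≤ n → ∀ v : V, eProj n q l 1 • v = 0) := by
  have hc := qSym_mul_ne_zero hq hl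
  rw [factorsThrough_span_iff]
  constructor
  · intro h hn v
    exact (smul_smul_eq_zero_iff _ hc _ v).1
      (h _ ((mem_tlRelators_iff hq hl).2 ⟨1, le_rfl, by omega, rfl⟩) v)
  · intro h x hx v
    obtain ⟨j, hj, hjn, rfl⟩ := (mem_tlRelators_iff hq hl).1 hx
    exact (smul_smul_eq_zero_iff _ hc _ v).2
      (eProj_smul_eq_zero hq (by omega) (h (by omega)) hj hjn v)

/-- The eigenvalues of the Jucys-Murphy elements on the vector that labels `V`. -/
lemma IsLabelledBy.exists_contents {μ : YoungDiagram} (h : IsLabelledBy n q V μ) :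
    ∃ v : V, v ≠ 0 ∧ ∃ a : ℕ → ℂ, ∀ p < n,
      jm (q : ℂ) (fun t => heckeGen n q (t + 1)) p • v = algebraMap ℂ (Hecke n q) (a p) • v ∧
        (a p = 0 ∨ ∃ b ∈ μ, a p = contentValue q ((b.2 : ℤ) - b.1)) := by
  obtain ⟨Γ, hcard, hle, rfl, v, hv, hL⟩ := h
  have hmono : ∀ p m, p ≤ m → m ≤ n → Γ p ≤ Γ m := by
    intro p m hpm
    induction m, hpm using Nat.le_induction with
    | base => exact fun _ => le_rfl
    | succ m hm ih => exact fun hmn => (ih (by omega)).trans (hle m (by omega))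
  refine ⟨v, hv, ?_⟩
  suffices ∀ p, ∃ c : ℂ, p < n →
      jm (q : ℂ) (fun t => heckeGen n q (t + 1)) p • v = algebraMap ℂ (Hecke n q) c • v ∧
        (c = 0 ∨ ∃ b ∈ Γ n, c = contentValue q ((b.2 : ℤ) - b.1)) by
    choose a ha using this
    exact ⟨a, ha⟩
  intro p
  rcases Nat.eq_zero_or_pos p with rfl | hp
  -- `jm 0` is zero and corresponds to no Murphy operator `L_p` with `p ≥ 2`; the disjunct `a p = 0`
  -- accounts for it.
  · exact ⟨0, fun _ => ⟨by simp [jm], Or.inl rfl⟩⟩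
  by_cases hpn : p < n
  · obtain ⟨b, hb, hb'⟩ := Finset.exists_mem_notMem_of_card_lt_card
      (s := (Γ p).cells) (t := (Γ (p + 1)).cells) (by
        have h1 := hcard p hpn.le
        have h2 := hcard (p + 1) hpn
        rw [YoungDiagram.card] at h1 h2
        omega)
    refine ⟨contentValue q ((b.2 : ℤ) - b.1), fun _ => ⟨?_, Or.inr ⟨b, ?_, rfl⟩⟩⟩
    · rw [← murphy_eq]
      exact hL (p + 1) (by omega) (by omega) b (Finset.mem_sdiff.2 ⟨hb, hb'⟩)
    · exact hmono (p + 1) n hpn le_rfl ((YoungDiagram.mem_cells b).1 hb)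
  · exact ⟨0, fun h => absurd h hpn⟩

lemma jmChar_central (hq : 0 < q) (x : ℂ) (y : Hecke n q) :
    Commute y (jmChar (q : ℂ) (fun t => heckeGen n q (t + 1)) x n) := by
  have hQ : (q : ℂ) ≠ 0 := by exact_mod_cast hq.ne'
  induction y using Hecke.induction with
  | hc c => exact Algebra.commute_algebraMap_left c _
  | hg t ht =>
    exact (heckeSystem_heckeGen n q).commute_jmChar hQ x ht (by omega) (Or.inl (by omega))
  | hmul y z hy hz => exact hy.mul_left hz
  | hadd y z hy hz => exact hy.add_left hz

/-- The complex vector space that underlies a module of the Hecke algebra. -/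
abbrev Hecke.complexModule (n : ℕ) (q : ℝ) (V : Type*) [AddCommGroup V] [Module (Hecke n q) V] :
    Module ℂ V :=
  Module.compHom V (algebraMap ℂ (Hecke n q))

lemma Hecke.isScalarTower (n : ℕ) (q : ℝ) (V : Type*) [AddCommGroup V] [Module (Hecke n q) V] :
    letI := Hecke.complexModule n q V
    IsScalarTower ℂ (Hecke n q) V :=
  letI := Hecke.complexModule n q V
  ⟨fun c x v => by
    rw [Algebra.smul_def, mul_smul]
    rfl⟩

/-- A simple module labelled by a diagram with at most `l` columns is annihilated by the
symmetrizer of `l + 1` strands. -/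
lemma HasAtMostColumns.eProj_smul [IsSimpleModule (Hecke n q) V] (hq : 0 < q) {l : ℕ}
    (hl : 1 ≤ l) (hn : l + 1 ≤ n) (h : HasAtMostColumns n q l V) (v₀ : V) :
    eProj n q l 1 • v₀ = 0 := by
  let := Hecke.complexModule n q V
  have := Hecke.isScalarTower n q V
  have hQ : (q : ℂ) ≠ 0 := by exact_mod_cast hq.ne'
  have H := heckeSystem_heckeGen n q
  obtain ⟨μ, hμ, hcol⟩ := h
  obtain ⟨v, hv, a, ha⟩ := hμ.exists_contents
  rw [eProj_eq hq, smul_assoc]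
  refine smul_eq_zero_of_right _ ?_
  by_contra hw
  set w := sym (q : ℂ) (fun t => heckeGen n q (t + 1)) l • v₀
  have hjw : jm (q : ℂ) (fun t => heckeGen n q (t + 1)) l • w = contentValue q l • w := by
    rw [← mul_smul, HeckeSystem.jm_mul_of_absorb hQ (H.gen_mul_sym hQ (by omega)), smul_assoc,
      contentValue_natCast hq]
  have hZ := H.jmChar_smul_eq_zero hQ (m := n) (by omega) (by omega : l < n) hjw
  have hc := jmChar_central (n := n) hq (contentValue q l)
  set Z := jmChar (q : ℂ) (fun t => heckeGen n q (t + 1)) (contentValue q l) n with hZdef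
  -- `Z` is central, so its kernel is a submodule. It contains `w ≠ 0`, so by simplicity `Z` also
  -- kills the labelling vector, on which it acts by a product over contents.
  let W : Submodule (Hecke n q) V :=
    { carrier := {u | Z • u = 0}
      add_mem' := fun {x y} hx hy => by
        rw [Set.mem_ofPred_eq] at hx hy ⊢
        rw [smul_add, hx, hy, add_zero]
      zero_mem' := smul_zero Z
      smul_mem' := fun y u hu => by
        rw [Set.mem_ofPred_eq] at hu ⊢
        rw [← mul_smul, ← (hc y).eq, mul_smul, hu, smul_zero] }
  have hW : W = ⊤ := (eq_bot_or_eq_top W).resolve_left fun h0 => hw (by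
    have : w ∈ W := hZ
    rwa [h0, Submodule.mem_bot] at this)
  have hZv : Z • v = 0 := by
    have : v ∈ W := hW ▸ Submodule.mem_top
    exact this
  rw [hZdef, jmChar_smul (a := a) fun p hp => by rw [(ha p hp).1, algebraMap_smul]] at hZv
  obtain ⟨p, hp, hpz⟩ := Finset.prod_eq_zero_iff.1 ((smul_eq_zero.1 hZv).resolve_right hv)
  rw [Finset.mem_range] at hp
  rw [sub_eq_zero] at hpz
  rcases (ha p hp).2 with h0 | ⟨b, hb, hbe⟩
  · rw [h0, ← contentValue_zero q] at hpz
    have := contentValue_injective hq hpz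
    omega
  · rw [hbe] at hpz
    have h1 := contentValue_injective hq hpz
    have h2 := YoungDiagram.mem_iff_lt_rowLen.1 (show (b.1, b.2) ∈ μ from hb)
    have h3 := μ.rowLen_anti 0 b.1 (Nat.zero_le _)
    omega

/-- A simple module that is annihilated by the symmetrizer of `l + 1` strands is labelled by a
diagram with at most `l` columns. -/
lemma hasAtMostColumns_of_eProj_smul [IsSimpleModule (Hecke n q) V] (hq : 0 < q) {l : ℕ}
    (h : l + 1 ≤ n → ∀ v : V, eProj n q l 1 • v = 0) : HasAtMostColumns n q l V := by
  let := Hecke.complexModule n q V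
  have := Hecke.isScalarTower n q V
  have : Module.Finite ℂ V := Module.Finite.trans (Hecke n q) V
  have := IsSimpleModule.nontrivial (Hecke n q) V
  rcases Nat.eq_zero_or_pos n with rfl | hn
  · obtain ⟨v, hv⟩ := exists_ne (0 : V)
    exact ⟨⊥, ⟨fun _ => ⊥, by simp, by simp, rfl, v, hv, by omega⟩, by simp⟩
  let φ := Algebra.lsmul ℂ ℂ V (A := Hecke n q)
  have H := (heckeSystem_heckeGen n q).map φ
  have hW := H.weightSystem hq
  rw [Nat.sub_add_cancel hn] at hW
  obtain ⟨v₀, hv₀⟩ := exists_ne (0 : V)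
  obtain ⟨s, Γ, ⟨_, v, hv, hmem⟩, hlen, hΓ, hrow⟩ :=
    hW.exists_chain ⟨by simp, v₀, hv₀, Submodule.mem_top⟩
  have hjm : ∀ (i : ℕ) (c : ℤ), s[i]? = some c →
      jm (q : ℂ) (fun t => heckeGen n q (t + 1)) i • v = contentValue q c • v := by
    intro i c hi
    rw [← apply_of_mem_weightSpace hmem i c hi, zero_add, ← map_jm φ]
    rfl
  refine ⟨Γ n, ⟨Γ, hΓ.card, hΓ.le, rfl, v, hv, fun p hp hpn b hb => ?_⟩, ?_⟩
  · obtain ⟨p, rfl⟩ : ∃ p', p = p' + 1 := ⟨p - 1, by omega⟩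
    rw [murphy_eq, hjm p _ (hΓ.content p (by omega) b hb)]
    rfl
  · by_contra hlt
    have hrn : (Γ n).rowLen 0 ≤ n := by simpa [hlen] using hrow.length_le
    have h0 := h (by omega) v
    rw [eProj_eq hq, smul_smul_eq_zero_iff _ (by exact_mod_cast qSym_succ_ne_zero hq l),
      HeckeSystem.sym_smul_of_jm_smul (qNum_ne_zero hq)] at h0
    · exact hv h0
    · intro k hk
      -- For `k ≤ l` the weight begins with the first row, whose entry `k` is the content `k`.
      rw [hjm k k, contentValue_natCast hq]
      obtain ⟨t, rfl⟩ := hrow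
      have hkr : k < (Γ n).rowLen 0 := by omega
      rw [List.getElem?_append_left (by rwa [length_rowList]), rowList, List.getElem?_map,
        List.getElem?_range hkr]
      simp

end Modules

/-- A two-sided ideal whose simple modules are annihilated by an idempotent contains it. -/
lemma TwoSidedIdeal.mem_of_idempotent {R : Type*} [Ring R] (K : TwoSidedIdeal R) {e : R}
    (he : e * e = e)
    (h : ∀ M : Ideal R, M.IsMaximal → (∀ x ∈ K, ∀ v : R ⧸ M, x • v = 0) →
      ∀ v : R ⧸ M, e • v = 0) : e ∈ K := by
  by_contra hK
  -- A maximal left ideal over `J` contains `K`, hence `e` by hypothesis, and also `1 - e` since `(1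
  -- - e) * e = 0`.
  let J : Ideal R :=
    { carrier := {x | x * e ∈ K}
      add_mem' := fun {x y} hx hy => by
        rw [Set.mem_ofPred_eq] at hx hy ⊢
        rw [add_mul]
        exact K.add_mem hx hy
      zero_mem' := by
        rw [Set.mem_ofPred_eq, zero_mul]
        exact K.zero_mem
      smul_mem' := fun y x hx => by
        rw [Set.mem_ofPred_eq] at hx ⊢
        rw [smul_eq_mul, mul_assoc]
        exact K.mul_mem_left _ _ hx }
  have hJ : J ≠ ⊤ := fun h1 => hK (by
    have : (1 : R) ∈ J := h1 ▸ Submodule.mem_top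
    simpa [J] using this)
  obtain ⟨M, hM, hJM⟩ := J.exists_le_maximal hJ
  have hKM : ∀ x ∈ K, x ∈ M := fun x hx => hJM (K.mul_mem_right x e hx)
  have h1 : e ∈ M := by
    have := h M hM (fun x hx v => by
      obtain ⟨y, rfl⟩ := Submodule.Quotient.mk_surjective M v
      rw [← Submodule.Quotient.mk_smul, Submodule.Quotient.mk_eq_zero]
      exact hKM _ (K.mul_mem_right x y hx)) (Submodule.Quotient.mk 1)
    rw [← Submodule.Quotient.mk_smul, Submodule.Quotient.mk_eq_zero] at this
    simpa using this
  have h2 : 1 - e ∈ M := hJM (by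
    change (1 - e) * e ∈ K
    rw [sub_mul, one_mul, he, sub_self]
    exact K.zero_mem)
  exact hM.ne_top (M.eq_top_iff_one.2 (by simpa using M.add_mem h2 h1))

lemma isTemperleyLiebMartin_span (hq : 0 < q) {l : ℕ} (hl : 2 ≤ l) :
    IsTemperleyLiebMartin n q l (TwoSidedIdeal.span (tlRelators n q (l - 1))) where
  irreps V _ _ _ := by
    rw [factorsThrough_tl_iff hq hl]
    exact ⟨hasAtMostColumns_of_eProj_smul hq, fun h hn => h.eProj_smul hq (by omega) hn⟩
  largest K hK := by
    have hQ : (q : ℂ) ≠ 0 := by exact_mod_cast hq.ne'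
    refine TwoSidedIdeal.span_le.2 fun x hx => ?_
    obtain ⟨j, hj, hjn, rfl⟩ := (mem_tlRelators_iff hq hl).1 hx
    rw [eProj_eq hq, smul_smul, Algebra.smul_def]
    refine K.mul_mem_left _ _ (K.mem_of_idempotent ?_ fun M hM hKM v => ?_)
    · exact (heckeSystem_shift hj (by omega) : HeckeSystem (q : ℂ) l _).sym_mul_sym hQ
        (qNum_ne_zero hq) le_rfl
    · have : IsSimpleModule (Hecke n q) (Hecke n q ⧸ M) := isSimpleModule_iff_isCoatom.2 hM.out
      have h := eProj_smul_eq_zero hq (by omega)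
        ((hK _ hKM).eProj_smul hq (by omega : 1 ≤ l) (by omega)) hj hjn v
      rwa [eProj_eq hq, smul_smul_eq_zero_iff _ (by exact_mod_cast qSym_succ_ne_zero hq l)] at h

end HeckeAlgebra

theorem mainTheorem2 (n : ℕ) (q : ℝ) (hq : 0 < q) :
    (∀ i j : ℕ, 1 ≤ i → 1 ≤ j → j + i ≤ n →
      eProj n q i j ^ 2 = ((qSym q (i + 1) : ℝ) : ℂ) • eProj n q i j) ∧
    (∀ i j : ℕ, 1 ≤ i → 1 ≤ j → j + i + 1 ≤ n →
      eProj n q (i + 1) j = ((1 / (qSym q i * qSym q (i + 1)) : ℝ) : ℂ) •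
        (eProj n q i j * eProj n q i (j + 1) * eProj n q i j - eProj n q i j)) ∧
    (∀ i j : ℕ, 1 ≤ i → 1 ≤ j → j + i + 1 ≤ n →
      eProj n q i j * eProj n q i (j + 1) * eProj n q i j - eProj n q i j =
        eProj n q i (j + 1) * eProj n q i j * eProj n q i (j + 1) - eProj n q i (j + 1)) ∧
    (∀ l : ℕ, 2 ≤ l →
      IsTemperleyLiebMartin n q l (TwoSidedIdeal.span (tlRelators n q (l - 1)))) := by
  refine ⟨fun i j _ hj hn => eProj_sq hq hj hn, fun i j hi hj hn => ?_,
    fun i j hi hj hn => eProj_braid_sub hq hi hj hn, fun l hl => isTemperleyLiebMartin_span hq hl⟩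
  have h0 : qSym q i * qSym q (i + 1) ≠ 0 := by
    obtain ⟨m, rfl⟩ : ∃ m, i = m + 1 := ⟨i - 1, by omega⟩
    exact mul_ne_zero (qSym_succ_ne_zero hq m) (qSym_succ_ne_zero hq (m + 1))
  rw [eProj_mul_mul_sub hq hi hj hn, smul_smul, ← Complex.ofReal_mul, one_div,
    inv_mul_cancel₀ h0, Complex.ofReal_one, one_smul]
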